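/- Let $s\ge 1$, $b\ge 2$ and $\alpha\ge 2$ be integers and let $1\le p\le\infty$. For $k\in\mathbb N_0$ with base-$b$ expansion $k=\kappa_0+\kappa_1b+\dots+\kappa_{m-1}b^{m-1}$ and $x\in[0,1)$ with base-$b$ expansion $x=x_1b^{-1}+x_2b^{-2}+\cdots$ (infinitely many digits different from $b-1$), let $\omega_k(x)=e^{\frac{2\pi i}{b}(\kappa_0x_1+\dots+\kappa_{m-1}x_m)}$, and for $\boldsymbol k\in\mathbb N_0^s$ let $\boldsymbol\omega_{\boldsymbol k}(\boldsymbol x)=\prod_{j=1}^s\omega_{k_j}(x_j)$. For an integrable $g:[0,1]^s\to\mathbb R$ and a finite $K\subset\mathbb N_0^s$ put $$\widehat g_{\boldsymbol k}=\int_{[0,1]^s}g(\boldsymbol x)\overline{\boldsymbol\omega_{\boldsymbol k}(\boldsymbol x)}\,d\boldsymbol x,\qquad g_K=\sum_{\boldsymbol k\in K}\widehat g_{\boldsymbol k}\,\boldsymbol\omega_{\boldsymbol k}.$$ For $\nu\in\mathbb N_0$ let $$K_\nu=\bigcup_{\boldsymbol d\in\mathbb N_0^s,\ d_1+\dots+d_s=\nu}\{\boldsymbol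 a\in\mathbb N_0^s:\ a_j<b^{d_j}\text{ for }1\le j\le s\}.$$ If $g$ has integrable weak mixed derivatives on $[0,1]^s$ of all orders in $\{0,\dots,\alpha\}^s$, define $\|g\|_{p,\alpha}\in[0,\infty]$ for $p<\infty$ by $$\|g\|_{p,\alpha}^p=\sum_{u\subseteq\{1,\dots,s\}}\ \sum_{v\subseteq u}\ \sum_{\tau\in\{1,\dots,\alpha-1\}^{|u\setminus v|}}\int_{[0,1]^{|v|}}\Big|\int_{[0,1]^{s-|v|}}\Big(\prod_{j\in v}\partial_{z_j}^{\alpha}\prod_{j\in u\setminus v}\partial_{z_j}^{\tau_j}\Big)g(\boldsymbol z)\,d\boldsymbol z_{\{1,\dots,s\}\setminus v}\Big|^p\,d\boldsymbol z_v,$$ and for $p=\infty$ as the maximum over $(u,v,\tau)$ of the $L^\infty([0,1]^{|v|})$ norms of the inner integrals; otherwise put $\|g\|_{p,\alpha}=\infty$. Then there is a constant $C>0$, which may depend on $s,b,\alpha,p$ but is independent of $g$ and $\nu$, such that for every $g:[0,1]^s\to\mathbb R$ with $\|g\|_{p,\alpha}<\infty$ and every integer $\nu\ge1$ $$\|g-g_{K_\nu}\|_{L^\infty([0,1]^s)}\le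 C\,\|g\|_{p,\alpha}\,\nu^{2s-1}\,b^{-\nu}.$$ -/

import Mathlib

open scoped ENNReal ComplexConjugate
open MeasureTheory

noncomputable section

namespace WalshTrunc

/-- The unit cube `[0,1]^ι`. -/
def cube (ι : Type*) : Set (ι → ℝ) := Set.Icc 0 1

/-! ### Walsh functions and truncated Walsh series -/

/-- The one-dimensional Walsh function
`ω_k(x) = exp (2πi/b (κ₀ x₁ + κ₁ x₂ + ⋯))`, where `κ_i = k / b^i % b` is the `i`-th base-`b` digit
of `k` and `x_{i+1} = ⌊x b^{i+1}⌋ % b` is the `(i+1)`-st digit of the base-`b` expansion of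
`x ∈ [0,1)` in which infinitely many digits differ from `b - 1`. -/
def walsh₁ (b k : ℕ) (x : ℝ) : ℂ :=
  Complex.exp (2 * Real.pi * Complex.I / b *
    ((∑ i ∈ Finset.range (Nat.digits b k).length,
      (k / b ^ i % b) * (⌊x * (b : ℝ) ^ (i + 1)⌋₊ % b) : ℕ) : ℂ))

/-- The `s`-dimensional Walsh function, a product of one-dimensional ones. -/
def walsh {s : ℕ} (b : ℕ) (k : Fin s → ℕ) (x : Fin s → ℝ) : ℂ :=
  ∏ j, walsh₁ b (k j) (x j)

/-- The `k`-th Walsh coefficient of `g`. -/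
def walshCoeff {s : ℕ} (b : ℕ) (g : (Fin s → ℝ) → ℝ) (k : Fin s → ℕ) : ℂ :=
  ∫ x in cube (Fin s), (g x : ℂ) * conj (walsh b k x)

/-- The truncated Walsh series `g_K`. -/
def walshPartial {s : ℕ} (b : ℕ) (K : Finset (Fin s → ℕ)) (g : (Fin s → ℝ) → ℝ)
    (x : Fin s → ℝ) : ℂ :=
  ∑ k ∈ K, walshCoeff b g k * walsh b k x

/-- `K_d`: the multi-indices `a` with `a j < b ^ d j` for all `j`. -/
def boxIndex {s : ℕ} (b : ℕ) (d : Fin s → ℕ) : Finset (Fin s → ℕ) :=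
  Fintype.piFinset fun j => Finset.range (b ^ d j)

/-- `K_ν`: the union of the `K_d` over all `d ∈ ℕ₀^s` with `d₁ + ⋯ + d_s = ν`. -/
def crossIndex (s b ν : ℕ) : Finset (Fin s → ℕ) :=
  (Finset.piAntidiag Finset.univ ν).biUnion (boxIndex b)

/-! ### Mixed weak derivatives -/

/-- The partial derivative in coordinate `j`. -/
def pderiv {s : ℕ} (j : Fin s) (φ : (Fin s → ℝ) → ℝ) : (Fin s → ℝ) → ℝ :=
  fun x => fderiv ℝ φ x (Pi.single j 1)

/-- The mixed partial derivative of order `β j` in coordinate `j`, for all `j`. -/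
def mixedDeriv {s : ℕ} (β : Fin s → ℕ) (φ : (Fin s → ℝ) → ℝ) : (Fin s → ℝ) → ℝ :=
  (List.finRange s).foldr (fun j f => (pderiv j)^[β j] f) φ

/-- `w ∈ L¹([0,1]^s)` is the weak mixed derivative of order `β` of `g ∈ L¹([0,1]^s)`; the test
functions are the smooth functions with compact support in the open unit cube. -/
structure IsWeakMixedDeriv {s : ℕ} (β : Fin s → ℕ) (g w : (Fin s → ℝ) → ℝ) : Prop where
  integrableOn : IntegrableOn g (cube (Fin s))
  integrableOn_deriv : IntegrableOn w (cube (Fin s))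
  integral_eq : ∀ φ : (Fin s → ℝ) → ℝ, ContDiff ℝ (⊤ : ℕ∞) φ → HasCompactSupport φ →
    tsupport φ ⊆ Set.univ.pi (fun _ => Set.Ioo (0 : ℝ) 1) →
    ∫ x in cube (Fin s), g x * mixedDeriv β φ x =
      (-1) ^ (∑ j, β j) * ∫ x in cube (Fin s), w x * φ x

/-- `D β` is the weak mixed derivative of order `β` of `g`, for all `β ∈ {0, …, α}^s`. -/
def IsWeakMixedDerivFamily {s : ℕ} (α : ℕ) (g : (Fin s → ℝ) → ℝ)
    (D : (Fin s → ℕ) → (Fin s → ℝ) → ℝ) : Prop :=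
  ∀ β : Fin s → ℕ, (∀ j, β j ≤ α) → IsWeakMixedDeriv β g (D β)

/-! ### The norm `‖g‖_{p,α}` -/

/-- The order of differentiation that belongs to `v` and `τ`: it is `α` in the coordinates in `v`,
`τ j` in the coordinates `j ∈ u \ v` and `0` in the coordinates outside `u`. -/
def derivOrder {s : ℕ} (α : ℕ) (u v : Finset (Fin s)) (τ : ↥(u \ v) → ℕ) : Fin s → ℕ :=
  fun j => if j ∈ v then α else if h : j ∈ u \ v then τ ⟨j, h⟩ else 0

/-- The integral of `f` over the coordinates outside `v`, as a function of the coordinates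
in `v`. -/
def integrateOut {s : ℕ} (v : Finset (Fin s)) (f : (Fin s → ℝ) → ℝ)
    (x : {j : Fin s // j ∈ v} → ℝ) : ℝ :=
  ∫ y in cube {j : Fin s // ¬ j ∈ v},
    f ((MeasurableEquiv.piEquivPiSubtypeProd (fun _ : Fin s => ℝ) (fun j => j ∈ v)).symm (x, y))

/-- The `L^p([0,1]^{|v|})` norm of the term of index `(u, v, τ)`. -/
def termNorm {s : ℕ} (p : ℝ≥0∞) (α : ℕ) (D : (Fin s → ℕ) → (Fin s → ℝ) → ℝ)
    (u v : Finset (Fin s)) (τ : ↥(u \ v) → ℕ) : ℝ≥0∞ :=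
  eLpNorm (integrateOut v (D (derivOrder α u v τ))) p
    (volume.restrict (cube {j : Fin s // j ∈ v}))

open Classical in
/-- The expression `‖·‖_{p,α}` in terms of a family `D` of mixed derivatives: the `ℓ^p` norm
(the maximum if `p = ∞`) of the terms with `v ⊆ u ⊆ {1,…,s}` and
`τ ∈ {1,…,α-1}^{u \ v}`. -/
def familyNorm {s : ℕ} (p : ℝ≥0∞) (α : ℕ) (D : (Fin s → ℕ) → (Fin s → ℝ) → ℝ) : ℝ≥0∞ :=
  if p = ∞ then
    ⨆ u : Finset (Fin s), ⨆ v ∈ u.powerset,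
      ⨆ τ ∈ Fintype.piFinset (fun _ : ↥(u \ v) => Finset.Icc 1 (α - 1)), termNorm ∞ α D u v τ
  else
    (∑ u : Finset (Fin s), ∑ v ∈ u.powerset,
      ∑ τ ∈ Fintype.piFinset (fun _ : ↥(u \ v) => Finset.Icc 1 (α - 1)),
        termNorm p α D u v τ ^ p.toReal) ^ (1 / p.toReal)

open Classical in
/-- The norm `‖g‖_{p,α}`. It is `∞` if `g` does not have integrable weak mixed derivatives of all
orders in `{0,…,α}^s`; otherwise these are unique almost everywhere, so that the value does not
depend on their choice. -/
def mixedNorm {s : ℕ} (p : ℝ≥0∞) (α : ℕ) (g : (Fin s → ℝ) → ℝ) : ℝ≥0∞ :=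
  if h : ∃ D, IsWeakMixedDerivFamily α g D then familyNorm p α h.choose else ∞

end WalshTrunc

end

noncomputable section

namespace WalshTrunc

/-! Sort the frequencies by the vector `a` of their base-`b` digit lengths. Then `K_ν` is the union
of the levels with `∑ a_j ≤ ν`, and the error consists of the level projections with `∑ a_j > ν`.
Each projection is the pairing of `g` with a product of one-dimensional kernels
(`walshPartial_piFinset`).

The kernel of level `a + 1` is a difference of two normalised cell indicators: it has mean zero,
`L¹` norm at most `2`, and lives on one `b`-adic cell of length `b⁻ᵃ`. Its primitive is bounded by
`2` on the same cell, so one integration by parts gains a factor `b⁻ᵃ`. The norm sees a derivative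
of order below `α` only after its coordinate is integrated out. Hence each later step splits the
current factor into its mean, which is kept, and a mean-zero part, which is integrated by parts
again until order `α` is reached. Doing this in every coordinate bounds a level by a constant times
`b^(-∑ a_j) ‖g‖` (`abs_tensorInt_levelKernels_le`). Weak derivatives are defined by smooth test
functions only; `tensorInt_update_eq_neg` extends integration by parts to bounded measurable
factors.

At most `(ν (l + 3))^s` levels have `∑ a_j = ν + 1 + l`, so the tail is `O(ν^s b^(-ν))`, and `s ≤ 2s
- 1`. Convergence of the series is not presupposed: the partial sums over full boxes are averages
over `b`-adic cubes and tend to `g` almost everywhere by Lebesgue differentiation. -/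

/-! ### The Walsh–Dirichlet kernel -/

theorem sum_range_mul_eq {M : Type*} [AddCommMonoid M] (f : ℕ → M) (m c : ℕ) :
    ∑ k ∈ Finset.range (m * c), f k =
      ∑ i ∈ Finset.range c, ∑ k ∈ Finset.range m, f (k + m * i) := by
  induction c with
  | zero => simp
  | succ c ih =>
    rw [Nat.mul_succ, Finset.sum_range_add, ih, Finset.sum_range_succ]
    simp only [add_comm]

theorem walsh₁_eq_of_lt {b : ℕ} (hb : 2 ≤ b) {k n : ℕ} (hk : k < b ^ n) (x : ℝ) :
    walsh₁ b k x = Complex.exp (2 * Real.pi * Complex.I / b *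
      ((∑ i ∈ Finset.range n, (k / b ^ i % b) * (⌊x * (b : ℝ) ^ (i + 1)⌋₊ % b) : ℕ) : ℂ)) := by
  have hlen : (Nat.digits b k).length ≤ n := (Nat.digits_length_le_iff (by omega) k).2 hk
  unfold walsh₁
  congr 3
  refine Finset.sum_subset (Finset.range_mono hlen) fun i _ hi => ?_
  have hi' : (Nat.digits b k).length ≤ i := by simpa using hi
  have : k < b ^ i := (Nat.digits_length_le_iff (by omega) k).1 hi'
  simp [Nat.div_eq_of_lt this]

/-- The leading digit `c` contributes a factor of its own, which permits induction on the number of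
digits. -/
theorem walsh₁_add_mul {b : ℕ} (hb : 2 ≤ b) {k n c : ℕ} (hk : k < b ^ n) (hc : c < b) (x : ℝ) :
    walsh₁ b (k + b ^ n * c) x =
      walsh₁ b k x * (Complex.exp (2 * Real.pi * Complex.I / b) ^
        (⌊x * (b : ℝ) ^ (n + 1)⌋₊ % b)) ^ c := by
  have hlt : k + b ^ n * c < b ^ (n + 1) := by
    calc k + b ^ n * c < b ^ n * (c + 1) := by rw [mul_add, mul_one]; omega
      _ ≤ b ^ n * b := Nat.mul_le_mul_left _ hc
      _ = _ := (pow_succ _ _).symm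
  rw [walsh₁_eq_of_lt hb hlt, walsh₁_eq_of_lt hb hk, Finset.sum_range_succ, ← pow_mul,
    ← Complex.exp_nat_mul, ← Complex.exp_add]
  have h1 : (k + b ^ n * c) / b ^ n % b = c := by
    rw [Nat.add_mul_div_left _ _ (by positivity), Nat.div_eq_of_lt hk, zero_add, Nat.mod_eq_of_lt hc]
  have h2 : ∀ i ∈ Finset.range n, (k + b ^ n * c) / b ^ i % b *
      (⌊x * (b : ℝ) ^ (i + 1)⌋₊ % b) = k / b ^ i % b * (⌊x * (b : ℝ) ^ (i + 1)⌋₊ % b) := by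
    intro i hi
    have hi : i < n := by simpa using hi
    obtain ⟨r, rfl⟩ := Nat.exists_eq_add_of_lt hi
    have : b ^ (i + r + 1) * c = b ^ i * (b * (b ^ r * c)) := by ring
    rw [this, Nat.add_mul_div_left _ _ (by positivity), Nat.add_mul_mod_self_left]
  rw [Finset.sum_congr rfl h2, h1]
  congr 1
  push_cast
  ring

theorem sum_pow_mul_conj_root {b : ℕ} (hb : 2 ≤ b) {d e : ℕ} (hd : d < b) (he : e < b) :
    ∑ c ∈ Finset.range b, (Complex.exp (2 * Real.pi * Complex.I / b) ^ d) ^ c *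
      conj ((Complex.exp (2 * Real.pi * Complex.I / b) ^ e) ^ c) = if d = e then (b : ℂ) else 0 := by
  have hζ := Complex.isPrimitiveRoot_exp b (by omega)
  set ζ := Complex.exp (2 * Real.pi * Complex.I / b) with hζdef
  have hn : ‖ζ‖ = 1 := hζ.norm'_eq_one (by omega)
  have hc : conj ζ = ζ⁻¹ := (Complex.inv_eq_conj hn).symm
  have h0 : ζ ≠ 0 := by rw [← norm_ne_zero_iff, hn]; exact one_ne_zero
  have hsum : ∀ c ∈ Finset.range b, (ζ ^ d) ^ c * conj ((ζ ^ e) ^ c) = (ζ ^ d * (ζ ^ e)⁻¹) ^ c := by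
    intro c _
    rw [map_pow, map_pow, hc, mul_pow, inv_pow]
  rw [Finset.sum_congr rfl hsum]
  split_ifs with h
  · subst h
    simp [h0]
  · have hne : ζ ^ d * (ζ ^ e)⁻¹ ≠ 1 := by
      intro h'
      rw [mul_inv_eq_one₀ (pow_ne_zero _ h0)] at h'
      exact h (hζ.pow_inj hd he h')
    have hb1 : (ζ ^ d * (ζ ^ e)⁻¹) ^ b = 1 := by
      rw [mul_pow, inv_pow, ← pow_mul, ← pow_mul, mul_comm d, mul_comm e, pow_mul, pow_mul,
        hζ.pow_eq_one]
      simp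
    rw [geom_sum_eq hne, hb1]
    simp

theorem floor_mul_pow_succ_div {b : ℕ} (hb : 2 ≤ b) (n : ℕ) (x : ℝ) :
    ⌊x * (b : ℝ) ^ (n + 1)⌋₊ / b = ⌊x * (b : ℝ) ^ n⌋₊ := by
  rw [← Nat.floor_div_natCast, pow_succ, ← mul_assoc, mul_div_cancel_right₀]
  have : (0 : ℝ) < b := by exact_mod_cast (by omega : 0 < b)
  exact this.ne'

/-- The Walsh–Dirichlet kernel of order `b ^ n` is `b ^ n` times the indicator of the relation
of lying in the same `b`-adic interval of length `b⁻ⁿ`. -/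
theorem sum_walsh₁_mul_conj {b : ℕ} (hb : 2 ≤ b) {x z : ℝ} (hxz : ⌊x⌋₊ = ⌊z⌋₊) (n : ℕ) :
    ∑ k ∈ Finset.range (b ^ n), walsh₁ b k x * conj (walsh₁ b k z) =
      if ⌊x * (b : ℝ) ^ n⌋₊ = ⌊z * (b : ℝ) ^ n⌋₊ then (b : ℂ) ^ n else 0 := by
  induction n with
  | zero => simp [walsh₁, hxz]
  | succ n ih =>
    set ζ := Complex.exp (2 * Real.pi * Complex.I / b) with hζdef
    set d := ⌊x * (b : ℝ) ^ (n + 1)⌋₊ with hd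
    set e := ⌊z * (b : ℝ) ^ (n + 1)⌋₊ with he
    have hterm : ∀ c ∈ Finset.range b, ∑ k ∈ Finset.range (b ^ n),
        walsh₁ b (k + b ^ n * c) x * conj (walsh₁ b (k + b ^ n * c) z) =
        (∑ k ∈ Finset.range (b ^ n), walsh₁ b k x * conj (walsh₁ b k z)) *
          ((ζ ^ (d % b)) ^ c * conj ((ζ ^ (e % b)) ^ c)) := by
      intro c hc
      rw [Finset.sum_mul]
      refine Finset.sum_congr rfl fun k hk => ?_
      rw [walsh₁_add_mul hb (by simpa using hk) (by simpa using hc),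
        walsh₁_add_mul hb (by simpa using hk) (by simpa using hc), map_mul]
      ring
    rw [pow_succ, sum_range_mul_eq, Finset.sum_congr rfl hterm, ← Finset.mul_sum, ih,
      sum_pow_mul_conj_root hb (Nat.mod_lt _ (by omega)) (Nat.mod_lt _ (by omega)),
      ← floor_mul_pow_succ_div hb n x, ← floor_mul_pow_succ_div hb n z, ← hd, ← he]
    -- Two points share a cell of the finer scale iff they share the parent cell and the next digit.
    have hiff : d = e ↔ d / b = e / b ∧ d % b = e % b := by
      constructor
      · rintro h; rw [h]; exact ⟨rfl, rfl⟩
      · rintro ⟨h1, h2⟩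
        rw [← Nat.div_add_mod d b, ← Nat.div_add_mod e b, h1, h2]
    by_cases h1 : d / b = e / b <;> by_cases h2 : d % b = e % b <;> simp [hiff, h1, h2, pow_succ]

/-! ### Bounded functions and primitives on the unit interval -/

/-- Lebesgue measure on the unit interval. -/
abbrev unitVol : Measure ℝ := volume.restrict (Set.Icc 0 1)

instance isProbabilityMeasure_unitVol : IsProbabilityMeasure unitVol :=
  ⟨by simp [unitVol]⟩

theorem ae_unitVol_mem : ∀ᵐ z ∂unitVol, z ∈ Set.Ico (0 : ℝ) 1 := by
  rw [unitVol, ← restrict_Ico_eq_restrict_Icc]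
  exact ae_restrict_mem measurableSet_Ico

/-- `h` is measurable and bounded by `M`. -/
structure BddMeas (M : ℝ) (h : ℝ → ℝ) : Prop where
  measurable : Measurable h
  bound : ∀ x, |h x| ≤ M

namespace BddMeas

variable {M N : ℝ} {h k : ℝ → ℝ}

theorem nonneg (hh : BddMeas M h) : 0 ≤ M := (abs_nonneg _).trans (hh.bound 0)

theorem mono (hh : BddMeas M h) (hMN : M ≤ N) : BddMeas N h :=
  ⟨hh.1, fun x => (hh.2 x).trans hMN⟩

theorem const (c : ℝ) : BddMeas |c| (fun _ => c) := ⟨measurable_const, fun _ => le_rfl⟩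

theorem sub (hh : BddMeas M h) (hk : BddMeas N k) : BddMeas (M + N) (fun x => h x - k x) :=
  ⟨hh.1.sub hk.1, fun x => (abs_sub _ _).trans (add_le_add (hh.2 x) (hk.2 x))⟩

theorem integrable (hh : BddMeas M h) : Integrable h unitVol :=
  Integrable.of_bound hh.1.aestronglyMeasurable M (Filter.Eventually.of_forall hh.2)

theorem abs_integral_le (hh : BddMeas M h) : ∫ z, |h z| ∂unitVol ≤ M := by
  have := integral_mono hh.integrable.abs (integrable_const M) hh.2
  simpa using this

end BddMeas

/-- The primitive of `q`, restricted to the unit interval, that vanishes at `0`. -/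
def prim (q : ℝ → ℝ) (t : ℝ) : ℝ := ∫ z in Set.Iic t, q z ∂unitVol

theorem abs_prim_le {q : ℝ → ℝ} (hq : Integrable q unitVol) (t : ℝ) :
    |prim q t| ≤ ∫ z, |q z| ∂unitVol :=
  abs_integral_le_integral_abs.trans
    (setIntegral_le_integral hq.abs (Filter.Eventually.of_forall fun _ => abs_nonneg _))

theorem measurable_prim {q : ℝ → ℝ} (hq : Measurable q) : Measurable (prim q) := by
  have h : StronglyMeasurable fun p : ℝ × ℝ => {p : ℝ × ℝ | p.2 ≤ p.1}.indicator (fun p => q p.2) p :=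
    ((hq.comp measurable_snd).indicator
      (measurableSet_le measurable_snd measurable_fst)).stronglyMeasurable
  have h' := (h.integral_prod_right' (ν := unitVol)).measurable
  convert h' using 1
  funext t
  rw [prim, ← integral_indicator measurableSet_Iic]
  rfl

theorem bddMeas_prim {q : ℝ → ℝ} {M : ℝ} (hq : BddMeas M q) :
    BddMeas (∫ z, |q z| ∂unitVol) (prim q) :=
  ⟨measurable_prim hq.1, abs_prim_le hq.integrable⟩

/-! ### Cell kernels and level kernels -/

/-- The kernel of the conditional expectation given the `b`-adic intervals of length `b⁻ⁿ`. -/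
def cellKernel (b n : ℕ) (x z : ℝ) : ℝ :=
  if ⌊x * (b : ℝ) ^ n⌋₊ = ⌊z * (b : ℝ) ^ n⌋₊ then (b : ℝ) ^ n else 0

/-- The kernel of the projection onto the Walsh functions `ω_k` such that `k` has exactly `a`
digits. -/
def levelKernel (b : ℕ) : ℕ → ℝ → ℝ → ℝ
  | 0, _, _ => 1
  | a + 1, x, z => cellKernel b (a + 1) x z - cellKernel b a x z

theorem bddMeas_cellKernel (b n : ℕ) (x : ℝ) : BddMeas ((b : ℝ) ^ n) (cellKernel b n x) := by
  refine ⟨?_, fun z => ?_⟩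
  · unfold cellKernel
    refine Measurable.ite ?_ measurable_const measurable_const
    exact measurableSet_eq_fun measurable_const
      (Nat.measurable_floor.comp (measurable_id.mul_const _))
  · unfold cellKernel
    split_ifs
    · rw [abs_of_nonneg (by positivity)]
    · simp

theorem bddMeas_levelKernel (b a : ℕ) (x : ℝ) : ∃ M, BddMeas M (levelKernel b a x) := by
  cases a with
  | zero => exact ⟨_, BddMeas.const 1⟩
  | succ a => exact ⟨_, (bddMeas_cellKernel b (a + 1) x).sub (bddMeas_cellKernel b a x)⟩

/-- The left-closed `b`-adic interval of length `b⁻ⁿ` with index `m`. -/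
def cell (b n m : ℕ) : Set ℝ := Set.Ico (m / (b : ℝ) ^ n) ((m + 1) / (b : ℝ) ^ n)

theorem mem_cell_iff {b n m : ℕ} (hb : 2 ≤ b) {z : ℝ} (hz : 0 ≤ z) :
    z ∈ cell b n m ↔ m = ⌊z * (b : ℝ) ^ n⌋₊ := by
  have hb0 : (0 : ℝ) < (b : ℝ) ^ n := by
    have : (0 : ℝ) < b := by exact_mod_cast (by omega : 0 < b)
    positivity
  rw [eq_comm, Nat.floor_eq_iff (by positivity), cell, Set.mem_Ico, div_le_iff₀ hb0, lt_div_iff₀ hb0]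

/-- The sign condition matters: `⌊·⌋₊` sends every negative number to `0`. -/
theorem cellKernel_eq_indicator {b n : ℕ} (hb : 2 ≤ b) (x : ℝ) {z : ℝ} (hz : 0 ≤ z) :
    cellKernel b n x z = (cell b n ⌊x * (b : ℝ) ^ n⌋₊).indicator (fun _ => (b : ℝ) ^ n) z := by
  classical
  rw [cellKernel, Set.indicator_apply]
  simp only [mem_cell_iff hb hz]

theorem volume_cell {b n m : ℕ} : volume.real (cell b n m) = ((b : ℝ) ^ n)⁻¹ := by
  rw [cell, Real.volume_real_Ico_of_le (by gcongr; linarith)]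
  ring

theorem cell_subset {b n : ℕ} (hb : 2 ≤ b) {x : ℝ} (hx : x ∈ Set.Ico (0 : ℝ) 1) :
    cell b n ⌊x * (b : ℝ) ^ n⌋₊ ⊆ Set.Icc 0 1 := by
  have hb0 : (0 : ℝ) < (b : ℝ) ^ n := by
    have : (0 : ℝ) < b := by exact_mod_cast (by omega : 0 < b)
    positivity
  intro z hz
  refine ⟨le_trans (by positivity) hz.1, hz.2.le.trans ?_⟩
  rw [div_le_one hb0]
  have : ⌊x * (b : ℝ) ^ n⌋₊ < b ^ n := by
    rw [Nat.floor_lt (mul_nonneg hx.1 hb0.le)]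
    push_cast
    nlinarith [hx.2]
  exact_mod_cast this

theorem measurableSet_cell {b n m : ℕ} : MeasurableSet (cell b n m) := measurableSet_Ico

theorem unitVol_real_cell {b n : ℕ} (hb : 2 ≤ b) {x : ℝ} (hx : x ∈ Set.Ico (0 : ℝ) 1) :
    unitVol.real (cell b n ⌊x * (b : ℝ) ^ n⌋₊) = ((b : ℝ) ^ n)⁻¹ := by
  rw [measureReal_restrict_apply measurableSet_cell, Set.inter_eq_left.2 (cell_subset hb hx),
    volume_cell]

theorem integral_cellKernel {b n : ℕ} (hb : 2 ≤ b) {x : ℝ} (hx : x ∈ Set.Ico (0 : ℝ) 1) :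
    ∫ z, cellKernel b n x z ∂unitVol = 1 := by
  have hb0 : (0 : ℝ) < (b : ℝ) ^ n := by
    have : (0 : ℝ) < b := by exact_mod_cast (by omega : 0 < b)
    positivity
  have h : cellKernel b n x =ᵐ[unitVol]
      (cell b n ⌊x * (b : ℝ) ^ n⌋₊).indicator (fun _ => (b : ℝ) ^ n) := by
    filter_upwards [ae_unitVol_mem] with z hz using cellKernel_eq_indicator hb x hz.1
  rw [integral_congr_ae h, integral_indicator measurableSet_cell, setIntegral_const,
    unitVol_real_cell hb hx, smul_eq_mul, inv_mul_cancel₀ hb0.ne']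

theorem integral_levelKernel_succ {b a : ℕ} (hb : 2 ≤ b) {x : ℝ} (hx : x ∈ Set.Ico (0 : ℝ) 1) :
    ∫ z, levelKernel b (a + 1) x z ∂unitVol = 0 := by
  simp only [levelKernel]
  rw [integral_sub (bddMeas_cellKernel ..).integrable (bddMeas_cellKernel ..).integrable,
    integral_cellKernel hb hx, integral_cellKernel hb hx, sub_self]

theorem levelKernel_succ_eq_zero {b a : ℕ} (hb : 2 ≤ b) (x : ℝ) {z : ℝ} (hz0 : 0 ≤ z)
    (hz : z ∉ cell b a ⌊x * (b : ℝ) ^ a⌋₊) : levelKernel b (a + 1) x z = 0 := by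
  rw [mem_cell_iff hb hz0] at hz
  have h2 : ⌊x * (b : ℝ) ^ (a + 1)⌋₊ ≠ ⌊z * (b : ℝ) ^ (a + 1)⌋₊ := by
    intro h
    apply hz
    rw [← floor_mul_pow_succ_div hb a x, ← floor_mul_pow_succ_div hb a z, h]
  simp [levelKernel, cellKernel, hz, h2]

theorem integral_abs_levelKernel_succ_le {b a : ℕ} (hb : 2 ≤ b) {x : ℝ}
    (hx : x ∈ Set.Ico (0 : ℝ) 1) : ∫ z, |levelKernel b (a + 1) x z| ∂unitVol ≤ 2 := by
  have hi := fun n => (bddMeas_cellKernel b n x).integrable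
  have hnn : ∀ n z, 0 ≤ cellKernel b n x z := by
    intro n z
    unfold cellKernel
    split_ifs <;> positivity
  calc ∫ z, |levelKernel b (a + 1) x z| ∂unitVol
      ≤ ∫ z, (cellKernel b (a + 1) x z + cellKernel b a x z) ∂unitVol := by
        refine integral_mono ((hi (a + 1)).sub (hi a)).abs ((hi (a + 1)).add (hi a)) fun z => ?_
        refine (abs_sub _ _).trans ?_
        rw [abs_of_nonneg (hnn _ _), abs_of_nonneg (hnn _ _)]
    _ = 2 := by
        rw [integral_add (hi _) (hi _), integral_cellKernel hb hx, integral_cellKernel hb hx]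
        norm_num

/-- To the left of the cell nothing has been integrated yet; to the right the whole mean-zero kernel
has been. -/
theorem prim_levelKernel_succ_eq_zero {b a : ℕ} (hb : 2 ≤ b) {x : ℝ}
    (hx : x ∈ Set.Ico (0 : ℝ) 1) {t : ℝ} (ht : t ∉ cell b a ⌊x * (b : ℝ) ^ a⌋₊) :
    prim (levelKernel b (a + 1) x) t = 0 := by
  obtain ⟨M, hM⟩ := bddMeas_levelKernel b (a + 1) x
  have h0 := integral_levelKernel_succ (a := a) hb hx
  rcases lt_or_ge t (⌊x * (b : ℝ) ^ a⌋₊ / (b : ℝ) ^ a) with h | h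
  · rw [prim]
    refine integral_eq_zero_of_ae ?_
    filter_upwards [ae_restrict_mem measurableSet_Iic, ae_restrict_of_ae ae_unitVol_mem]
      with z hz hz0
    exact levelKernel_succ_eq_zero hb x hz0.1 fun hc => absurd hc.1 (not_le.2 (hz.trans_lt h))
  · have h' : (⌊x * (b : ℝ) ^ a⌋₊ + 1) / (b : ℝ) ^ a ≤ t := by
      by_contra hlt
      exact ht ⟨h, not_le.1 hlt⟩
    have hsplit := integral_add_compl (measurableSet_Iic (a := t)) hM.integrable
    have hz : ∫ z in (Set.Iic t)ᶜ, levelKernel b (a + 1) x z ∂unitVol = 0 := by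
      refine integral_eq_zero_of_ae ?_
      filter_upwards [ae_restrict_mem measurableSet_Iic.compl, ae_restrict_of_ae ae_unitVol_mem]
        with z hz hz0
      have hz : t < z := by simpa using hz
      exact levelKernel_succ_eq_zero hb x hz0.1 fun hc => absurd hc.2 (not_lt.2 (h'.trans hz.le))
    rw [hz, add_zero, h0] at hsplit
    exact hsplit

/-- The primitive is at most the `L¹` norm `2` of the kernel, on a cell of length `b⁻ᵃ`. This is the
only source of decay in the proof. -/
theorem integral_abs_prim_levelKernel_succ_le {b a : ℕ} (hb : 2 ≤ b) {x : ℝ}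
    (hx : x ∈ Set.Ico (0 : ℝ) 1) :
    ∫ t, |prim (levelKernel b (a + 1) x) t| ∂unitVol ≤ 2 * ((b : ℝ) ^ a)⁻¹ := by
  obtain ⟨M, hM⟩ := bddMeas_levelKernel b (a + 1) x
  have hP := bddMeas_prim hM
  calc ∫ t, |prim (levelKernel b (a + 1) x) t| ∂unitVol
      ≤ ∫ t, (cell b a ⌊x * (b : ℝ) ^ a⌋₊).indicator (fun _ => (2 : ℝ)) t ∂unitVol := by
        refine integral_mono hP.integrable.abs
          ((integrable_const _).indicator measurableSet_cell) fun t => ?_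
        by_cases ht : t ∈ cell b a ⌊x * (b : ℝ) ^ a⌋₊
        · simp only [Set.indicator_of_mem ht]
          exact (hP.bound t).trans (integral_abs_levelKernel_succ_le hb hx)
        · simp [Set.indicator_of_notMem ht, prim_levelKernel_succ_eq_zero hb hx ht]
    _ = 2 * ((b : ℝ) ^ a)⁻¹ := by
        rw [integral_indicator measurableSet_cell, setIntegral_const, unitVol_real_cell hb hx,
          smul_eq_mul, mul_comm]

/-! ### Test functions and approximation by them -/

/-- The smooth functions with compact support in the open unit interval. -/
structure TestFun (φ : ℝ → ℝ) : Prop where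
  contDiff : ContDiff ℝ (⊤ : ℕ∞) φ
  support : ∃ a b : ℝ, 0 < a ∧ b < 1 ∧ Function.support φ ⊆ Set.Icc a b

namespace TestFun

variable {φ ψ : ℝ → ℝ}

theorem deriv (hφ : TestFun φ) : TestFun (deriv φ) := by
  obtain ⟨h, a, b, ha, hb, hs⟩ := hφ
  exact ⟨(contDiff_infty_iff_deriv.1 h).2, a, b, ha, hb,
    support_deriv_subset.trans (closure_minimal hs isClosed_Icc)⟩

theorem iterate_deriv (hφ : TestFun φ) (n : ℕ) : TestFun (_root_.deriv^[n] φ) := by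
  induction n generalizing φ with
  | zero => exact hφ
  | succ n ih => exact ih hφ.deriv

theorem sub_const_mul (hφ : TestFun φ) (hψ : TestFun ψ) (c : ℝ) :
    TestFun (fun x => φ x - c * ψ x) := by
  obtain ⟨h, a, b, ha, hb, hs⟩ := hφ
  obtain ⟨h', a', b', ha', hb', hs'⟩ := hψ
  refine ⟨h.sub (contDiff_const.mul h'), min a a', max b b', lt_min ha ha', max_lt hb hb', ?_⟩
  intro x hx
  by_contra hx'
  have h1 : φ x = 0 := by
    by_contra h1
    have := hs h1
    exact hx' ⟨(min_le_left _ _).trans this.1, this.2.trans (le_max_left _ _)⟩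
  have h2 : ψ x = 0 := by
    by_contra h2
    have := hs' h2
    exact hx' ⟨(min_le_right _ _).trans this.1, this.2.trans (le_max_right _ _)⟩
  exact hx (by simp [h1, h2])

theorem eq_zero_of_nonpos (hφ : TestFun φ) {x : ℝ} (hx : x ≤ 0) : φ x = 0 := by
  obtain ⟨h, a, b, ha, hb, hs⟩ := hφ
  by_contra h
  exact absurd (hs h).1 (not_le.2 (hx.trans_lt ha))

theorem prim_eq (hφ : TestFun φ) (t : ℝ) : prim φ t = ∫ z in (0 : ℝ)..t, φ z := by
  obtain ⟨h, a, b, ha, hb, hs⟩ := id hφ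
  have hint : Integrable φ := h.continuous.integrable_of_hasCompactSupport
    (HasCompactSupport.of_support_subset_isCompact isCompact_Icc hs)
  have h0 : ∫ z in Set.Iic (0 : ℝ), φ z = 0 :=
    setIntegral_eq_zero_of_forall_eq_zero fun z hz => hφ.eq_zero_of_nonpos hz
  have h1 := intervalIntegral.integral_Iic_sub_Iic (a := 0) (b := t) (μ := volume) (f := φ)
    hint.integrableOn hint.integrableOn
  rw [← h1, h0, sub_zero, prim, unitVol, Measure.restrict_restrict measurableSet_Iic]
  symm
  refine setIntegral_eq_of_subset_of_forall_sdiff_eq_zero measurableSet_Iic Set.inter_subset_left ?_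
  intro z hz
  by_contra hne
  exact hz.2 ⟨hz.1, ha.le.trans (hs hne).1, (hs hne).2.trans hb.le⟩

theorem deriv_prim (hφ : TestFun φ) : _root_.deriv (prim φ) = φ := by
  rw [funext hφ.prim_eq]
  funext t
  exact hφ.contDiff.continuous.deriv_integral φ 0 t

theorem integrable (hφ : TestFun φ) : Integrable φ unitVol := by
  obtain ⟨h, a, b, ha, hb, hs⟩ := hφ
  exact (h.continuous.integrable_of_hasCompactSupport
    (HasCompactSupport.of_support_subset_isCompact isCompact_Icc hs)).restrict

/-- Mean zero makes the primitive vanish to the right of the support, so compact support survives.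
-/
theorem prim (hφ : TestFun φ) (h0 : ∫ z, φ z ∂unitVol = 0) : TestFun (prim φ) := by
  obtain ⟨h, a, b, ha, hb, hs⟩ := id hφ
  refine ⟨?_, a, b, ha, hb, ?_⟩
  · rw [contDiff_infty_iff_deriv, hφ.deriv_prim]
    refine ⟨?_, h⟩
    rw [funext hφ.prim_eq]
    exact fun t => (intervalIntegral.integral_hasDerivAt_right
      (h.continuous.intervalIntegrable _ _) (h.continuous.stronglyMeasurableAtFilter _ _)
      h.continuous.continuousAt).differentiableAt
  · intro t ht
    by_contra hc
    apply ht
    rcases lt_or_ge t a with hta | hta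
    · refine setIntegral_eq_zero_of_forall_eq_zero fun z hz => ?_
      by_contra hne
      exact absurd (hs hne).1 (not_le.2 (lt_of_le_of_lt hz hta))
    · have htb : b < t := by
        by_contra hle
        exact hc ⟨hta, not_lt.1 hle⟩
      have hsplit := integral_add_compl (measurableSet_Iic (a := t)) hφ.integrable
      have hz : ∫ z in (Set.Iic t)ᶜ, φ z ∂unitVol = 0 := by
        refine setIntegral_eq_zero_of_forall_eq_zero fun z hz => ?_
        by_contra hne
        have hz : t < z := by simpa using hz
        exact absurd (hs hne).2 (not_le.2 (htb.trans hz))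
      rw [hz, add_zero, h0] at hsplit
      exact hsplit

end TestFun

theorem exists_testFun_integral_eq_one :
    ∃ ρ : ℝ → ℝ, TestFun ρ ∧ ∫ z, ρ z ∂unitVol = 1 ∧ ∃ M, BddMeas M ρ := by
  let f : ContDiffBump (1 / 2 : ℝ) := ⟨1 / 8, 1 / 4, by norm_num, by norm_num⟩
  have hsupp : Function.support (f.normed volume) ⊆ Set.Icc (1 / 4) (3 / 4) := by
    rw [f.support_normed_eq, Real.ball_eq_Ioo]
    intro x hx
    have h1 : (1 : ℝ) / 2 - 1 / 4 < x := hx.1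
    have h2 : x < (1 : ℝ) / 2 + 1 / 4 := hx.2
    constructor <;> linarith
  refine ⟨f.normed volume, ⟨f.contDiff_normed, 1 / 4, 3 / 4, by norm_num, by norm_num, hsupp⟩,
    ?_, ?_⟩
  · rw [unitVol, setIntegral_eq_integral_of_forall_compl_eq_zero, f.integral_normed]
    intro x hx
    by_contra hne
    have := hsupp hne
    exact hx ⟨by linarith [this.1], by linarith [this.2]⟩
  · obtain ⟨M, hM⟩ := (f.continuous_normed (μ := volume)).bounded_above_of_compact_support
      f.hasCompactSupport_normed
    exact ⟨M, f.continuous_normed.measurable, hM⟩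

-- Mollify, then cut off smoothly near the endpoints. The bound `M` is kept since the mollifier has
-- mass one and the cutoff is at most one.
open Filter Topology ContinuousLinearMap Convolution in
theorem BddMeas.exists_testFun_tendsto {M : ℝ} {h : ℝ → ℝ} (hh : BddMeas M h) :
    ∃ φ : ℕ → ℝ → ℝ, (∀ n, TestFun (φ n)) ∧ (∀ n, BddMeas M (φ n)) ∧
      ∀ᵐ z ∂unitVol, Tendsto (fun n => φ n z) atTop (𝓝 (h z)) := by
  -- The shift by `5` keeps the inner radius `1/2 - 2/(n+5)` of the cutoff positive already at `n =
  -- 0`.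
  have hpos : ∀ n : ℕ, (0 : ℝ) < 1 / ((n : ℝ) + 5) := fun n => by positivity
  have hle : ∀ n : ℕ, 1 / ((n : ℝ) + 5) ≤ 1 / 5 := fun n =>
    one_div_le_one_div_of_le (by norm_num) (by linarith [(Nat.cast_nonneg n : (0 : ℝ) ≤ n)])
  let ψ : ℕ → ContDiffBump (0 : ℝ) := fun n =>
    ⟨1 / ((n : ℝ) + 5), 2 * (1 / ((n : ℝ) + 5)), hpos n, by linarith [hpos n]⟩
  let χ : ℕ → ContDiffBump (1 / 2 : ℝ) := fun n =>
    ⟨1 / 2 - 2 * (1 / ((n : ℝ) + 5)), 1 / 2 - 1 / ((n : ℝ) + 5), by linarith [hle n],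
      by linarith [hpos n]⟩
  have hlim : Tendsto (fun n : ℕ => 1 / ((n : ℝ) + 5)) atTop (𝓝 0) := by
    refine Tendsto.div_atTop tendsto_const_nhds ?_
    exact tendsto_atTop_add_const_right _ _ tendsto_natCast_atTop_atTop
  have hloc : LocallyIntegrable h volume := by
    refine (locallyIntegrable_const M).mono hh.1.aestronglyMeasurable (Eventually.of_forall fun x => ?_)
    exact (hh.bound x).trans (le_abs_self M)
  let cv : ℕ → ℝ → ℝ := fun n => (ψ n).normed volume ⋆[lsmul ℝ ℝ, volume] h
  have hcvsmooth : ∀ n, ContDiff ℝ (⊤ : ℕ∞) (cv n) := fun n =>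
    (ψ n).hasCompactSupport_normed.contDiff_convolution_left _ (ψ n).contDiff_normed hloc
  have hcvbound : ∀ n x, |cv n x| ≤ M := by
    intro n x
    change ‖∫ t, (ψ n).normed volume t • h (x - t)‖ ≤ M
    refine (norm_integral_le_of_norm_le ((ψ n).integrable_normed.mul_const M)
      (Eventually.of_forall fun t => ?_)).trans ?_
    · rw [norm_smul, Real.norm_of_nonneg ((ψ n).nonneg_normed t)]
      exact mul_le_mul_of_nonneg_left (hh.bound _) ((ψ n).nonneg_normed t)
    · rw [integral_mul_const, (ψ n).integral_normed, one_mul]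
  have hcvlim : ∀ᵐ x, Tendsto (fun n => cv n x) atTop (𝓝 (h x)) := by
    refine ContDiffBump.ae_convolution_tendsto_right_of_locallyIntegrable (K := 2) ?_ ?_ hloc
    · have h2 := hlim.const_mul 2
      rw [mul_zero] at h2
      exact h2
    · exact Eventually.of_forall fun n => le_rfl
  have hsmooth : ∀ n, ContDiff ℝ (⊤ : ℕ∞) (fun x => χ n x * cv n x) := fun n =>
    (χ n).contDiff.mul (hcvsmooth n)
  refine ⟨fun n x => χ n x * cv n x, fun n => ⟨hsmooth n, 1 / ((n : ℝ) + 5),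
    1 - 1 / ((n : ℝ) + 5), hpos n, by linarith [hpos n], ?_⟩, fun n => ⟨?_, fun x => ?_⟩, ?_⟩
  · intro x hx
    have : x ∈ Function.support (χ n) := fun h0 => hx (by simp [h0])
    rw [(χ n).support_eq, Real.ball_eq_Ioo] at this
    have h1 : (1 : ℝ) / 2 - (1 / 2 - 1 / ((n : ℝ) + 5)) < x := this.1
    have h2 : x < (1 : ℝ) / 2 + (1 / 2 - 1 / ((n : ℝ) + 5)) := this.2
    constructor <;> linarith
  · exact (hsmooth n).continuous.measurable
  · rw [abs_mul, abs_of_nonneg (χ n).nonneg]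
    calc χ n x * |cv n x| ≤ 1 * M :=
          mul_le_mul (χ n).le_one (hcvbound n x) (abs_nonneg _) zero_le_one
      _ = M := one_mul M
  · have hIoo : ∀ᵐ z ∂unitVol, z ∈ Set.Ioo (0 : ℝ) 1 := by
      rw [unitVol, ← restrict_Ioo_eq_restrict_Icc]
      exact ae_restrict_mem measurableSet_Ioo
    filter_upwards [hIoo, ae_restrict_of_ae hcvlim] with z hz hzl
    have hev : ∀ᶠ n : ℕ in atTop, χ n z = 1 := by
      have hlim2 : Tendsto (fun n : ℕ => 2 * (1 / ((n : ℝ) + 5))) atTop (𝓝 0) := by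
        simpa using hlim.const_mul 2
      filter_upwards [hlim2.eventually (gt_mem_nhds (lt_min hz.1 (sub_pos.2 hz.2)))] with n hn
      apply (χ n).one_of_mem_closedBall
      rw [Real.closedBall_eq_Icc]
      have h1 := hn.trans_le (min_le_left _ _)
      have h2 := hn.trans_le (min_le_right _ _)
      change z ∈ Set.Icc (1 / 2 - (1 / 2 - 2 * (1 / ((n : ℝ) + 5))))
        (1 / 2 + (1 / 2 - 2 * (1 / ((n : ℝ) + 5))))
      constructor <;> linarith
    refine hzl.congr' ?_
    filter_upwards [hev] with n hn
    rw [hn, one_mul]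

/-! ### Tensor products and integration by parts -/

variable {s : ℕ}

theorem pderiv_prod (j : Fin s) {φ : Fin s → ℝ → ℝ} (hφ : ∀ i, Differentiable ℝ (φ i)) :
    pderiv j (fun x => ∏ i, φ i (x i)) =
      fun x => ∏ i, Function.update φ j (deriv (φ j)) i (x i) := by
  funext x
  have hd : DifferentiableAt ℝ (fun x : Fin s → ℝ => ∏ i, φ i (x i)) x := by
    have hi : ∀ i ∈ Finset.univ, DifferentiableAt ℝ (fun x : Fin s → ℝ => φ i (x i)) x :=
      fun i _ => (hφ i _).comp x (differentiableAt_apply i x)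
    exact (HasFDerivAt.finsetProd fun i h => (hi i h).hasFDerivAt).differentiableAt
  have h1 : HasDerivAt (fun t => ∏ i, φ i (Function.update x j t i)) (pderiv j (fun x => ∏ i, φ i (x i)) x) (x j) := by
    have hu := hasDerivAt_update (𝕜 := ℝ) x j (x j)
    have hd' : HasFDerivAt (fun x : Fin s → ℝ => ∏ i, φ i (x i))
        (fderiv ℝ (fun x : Fin s → ℝ => ∏ i, φ i (x i)) x) (Function.update x j (x j)) := by
      rw [Function.update_eq_self]
      exact hd.hasFDerivAt
    exact hd'.comp_hasDerivAt _ hu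
  have h2 : (fun t => ∏ i, φ i (Function.update x j t i)) =
      fun t => φ j t * ∏ i ∈ Finset.univ.erase j, φ i (x i) := by
    funext t
    rw [← Finset.mul_prod_erase _ _ (Finset.mem_univ j), Function.update_self]
    congr 1
    refine Finset.prod_congr rfl fun i hi => ?_
    rw [Function.update_of_ne (Finset.ne_of_mem_erase hi)]
  rw [h2] at h1
  have h3 := ((hφ j (x j)).hasDerivAt.mul_const (∏ i ∈ Finset.univ.erase j, φ i (x i)))
  rw [h1.unique h3, ← Finset.mul_prod_erase _ _ (Finset.mem_univ j), Function.update_self]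
  congr 1
  refine Finset.prod_congr rfl fun i hi => ?_
  rw [Function.update_of_ne (Finset.ne_of_mem_erase hi)]

theorem iterate_pderiv_prod (j : Fin s) (n : ℕ) {φ : Fin s → ℝ → ℝ} (hφ : ∀ i, TestFun (φ i)) :
    (pderiv j)^[n] (fun x => ∏ i, φ i (x i)) =
      fun x => ∏ i, Function.update φ j (deriv^[n] (φ j)) i (x i) := by
  induction n generalizing φ with
  | zero => simp
  | succ n ih =>
    rw [Function.iterate_succ_apply, pderiv_prod j fun i => (hφ i).contDiff.differentiable (by simp),
      ih]
    · simp
    · intro i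
      rcases eq_or_ne i j with rfl | h
      · simpa using (hφ i).deriv
      · simpa [h] using hφ i

theorem mixedDeriv_prod (β : Fin s → ℕ) {φ : Fin s → ℝ → ℝ} (hφ : ∀ i, TestFun (φ i)) :
    mixedDeriv β (fun x => ∏ i, φ i (x i)) = fun x => ∏ i, deriv^[β i] (φ i) (x i) := by
  have key : ∀ l : List (Fin s), l.Nodup →
      l.foldr (fun j f => (pderiv j)^[β j] f) (fun x => ∏ i, φ i (x i)) =
        fun x => ∏ i, (if i ∈ l then deriv^[β i] (φ i) else φ i) (x i) := by
    intro l
    induction l with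
    | nil => simp
    | cons j l ih =>
      intro hl
      obtain ⟨hj, hl⟩ := List.nodup_cons.1 hl
      rw [List.foldr_cons, ih hl, iterate_pderiv_prod]
      · funext x
        refine Finset.prod_congr rfl fun i _ => ?_
        rcases eq_or_ne i j with rfl | h
        · simp [hj]
        · simp [h]
      · intro i
        split_ifs
        · exact (hφ i).iterate_deriv _
        · exact hφ i
  rw [mixedDeriv, key _ (List.nodup_finRange s)]
  simp

/-- The integral over the unit cube of `f` times a tensor product. -/
def tensorInt (f : (Fin s → ℝ) → ℝ) (h : Fin s → ℝ → ℝ) : ℝ :=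
  ∫ z in cube (Fin s), f z * ∏ i, h i (z i)

theorem restrict_cube (ι : Type*) [Fintype ι] :
    (volume : Measure (ι → ℝ)).restrict (cube ι) = Measure.pi fun _ => unitVol := by
  rw [cube, ← Set.pi_univ_Icc, volume_pi, Measure.restrict_pi_pi]
  rfl

theorem ae_cube_of_ae_unitVol {ι : Type*} [Fintype ι] {P : ι → ℝ → Prop}
    (hP : ∀ i, ∀ᵐ z ∂unitVol, P i z) :
    ∀ᵐ z ∂(volume : Measure (ι → ℝ)).restrict (cube ι), ∀ i, P i (z i) := by
  rw [restrict_cube, ae_all_iff]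
  exact fun i => (Measure.quasiMeasurePreserving_eval _ i).ae (hP i)

theorem IsWeakMixedDeriv.tensorInt_eq {β : Fin s → ℕ} {g w : (Fin s → ℝ) → ℝ}
    (hw : IsWeakMixedDeriv β g w) {φ : Fin s → ℝ → ℝ} (hφ : ∀ i, TestFun (φ i)) :
    tensorInt g (fun i => deriv^[β i] (φ i)) = (-1) ^ (∑ j, β j) * tensorInt w φ := by
  choose hsm a b ha hb hs using fun i => (⟨(hφ i).contDiff, (hφ i).support⟩ :
    ContDiff ℝ (⊤ : ℕ∞) (φ i) ∧ ∃ a b : ℝ, 0 < a ∧ b < 1 ∧ Function.support (φ i) ⊆ Set.Icc a b)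
  have hsub : Function.support (fun x : Fin s → ℝ => ∏ i, φ i (x i)) ⊆
      Set.univ.pi fun i => Set.Icc (a i) (b i) := by
    intro x hx i _
    exact hs i fun h0 => hx (Finset.prod_eq_zero (Finset.mem_univ i) h0)
  have hcpt : IsCompact (Set.univ.pi fun i => Set.Icc (a i) (b i)) :=
    isCompact_univ_pi fun i => isCompact_Icc
  have h := hw.integral_eq (fun x => ∏ i, φ i (x i))
    (contDiff_prod fun i _ => (hsm i).comp (contDiff_apply ℝ ℝ i))
    (HasCompactSupport.of_support_subset_isCompact hcpt hsub)
    ((closure_minimal hsub hcpt.isClosed).trans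
      (Set.pi_mono fun i _ x hx => ⟨(ha i).trans_le hx.1, hx.2.trans_lt (hb i)⟩))
  rwa [mixedDeriv_prod β hφ] at h

/-- Up to sign, both sides are the pairing of `g` with the same derivatives; the two signs differ by
one factor `-1`. -/
theorem tensorInt_update_deriv_of_testFun {β : Fin s → ℕ} {g w w' : (Fin s → ℝ) → ℝ} {j : Fin s}
    (hw : IsWeakMixedDeriv β g w) (hw' : IsWeakMixedDeriv (Function.update β j (β j + 1)) g w')
    {φ : Fin s → ℝ → ℝ} (hφ : ∀ i, TestFun (φ i)) :
    tensorInt w (Function.update φ j (deriv (φ j))) = -tensorInt w' φ := by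
  have h1 := hw.tensorInt_eq (φ := Function.update φ j (deriv (φ j))) fun i => by
    rcases eq_or_ne i j with rfl | h
    · simpa using (hφ i).deriv
    · simpa [h] using hφ i
  have h2 := hw'.tensorInt_eq hφ
  have h3 : (fun i => deriv^[β i] (Function.update φ j (deriv (φ j)) i)) =
      fun i => deriv^[Function.update β j (β j + 1) i] (φ i) := by
    funext i
    rcases eq_or_ne i j with rfl | h
    · simp
    · simp [h]
  have h4 : ∑ i, Function.update β j (β j + 1) i = (∑ i, β i) + 1 := by
    rw [← Finset.add_sum_erase _ _ (Finset.mem_univ j),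
      ← Finset.add_sum_erase _ β (Finset.mem_univ j), Function.update_self]
    rw [Finset.sum_congr rfl fun i hi =>
      Function.update_of_ne (Finset.ne_of_mem_erase hi) (β j + 1) β]
    ring
  rw [h3, h2, h4, pow_succ] at h1
  have h5 : ((-1 : ℝ) ^ (∑ i, β i)) ≠ 0 := pow_ne_zero _ (by norm_num)
  refine mul_left_cancel₀ h5 ?_
  rw [← h1]
  ring

open Filter Topology in
theorem tendsto_tensorInt {f : (Fin s → ℝ) → ℝ} (hf : IntegrableOn f (cube (Fin s))) {M : ℝ}
    {φ : ℕ → Fin s → ℝ → ℝ} {h : Fin s → ℝ → ℝ} (hφ : ∀ n i, BddMeas M (φ n i))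
    (hlim : ∀ i, ∀ᵐ z ∂unitVol, Tendsto (fun n => φ n i z) atTop (𝓝 (h i z))) :
    Tendsto (fun n => tensorInt f (φ n)) atTop (𝓝 (tensorInt f h)) := by
  refine tendsto_integral_of_dominated_convergence (fun z => |f z| * M ^ s) (fun n => ?_)
    (hf.abs.mul_const _) (fun n => Eventually.of_forall fun z => ?_) ?_
  · refine hf.aestronglyMeasurable.mul (Measurable.aestronglyMeasurable ?_)
    exact Finset.measurable_fun_prod _ fun i _ => (hφ n i).1.comp (measurable_pi_apply i)
  · rw [norm_mul, Real.norm_eq_abs, Real.norm_eq_abs, Finset.abs_prod]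
    refine mul_le_mul_of_nonneg_left ?_ (abs_nonneg _)
    refine (Finset.prod_le_prod (fun i _ => abs_nonneg _) fun i _ => (hφ n i).2 (z i)).trans ?_
    simp
  · filter_upwards [ae_cube_of_ae_unitVol hlim] with z hz
    exact (tendsto_finsetProd _ fun i _ => hz i).const_mul _

/-- A weak derivative of order zero is tied to `g` only through test functions. Approximation
extends the identity to bounded factors, so `D 0` may replace `g`. -/
theorem tensorInt_eq_of_weak_zero {g w : (Fin s → ℝ) → ℝ} (hw : IsWeakMixedDeriv 0 g w) {M : ℝ}
    {h : Fin s → ℝ → ℝ} (hh : ∀ i, BddMeas M (h i)) : tensorInt g h = tensorInt w h := by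
  choose φ hφ hφM hlim using fun i => (hh i).exists_testFun_tendsto
  refine tendsto_nhds_unique
    (tendsto_tensorInt hw.integrableOn (fun n i => hφM i n) hlim) ?_
  refine (tendsto_tensorInt hw.integrableOn_deriv (fun n i => hφM i n) hlim).congr fun n => ?_
  have := hw.tensorInt_eq fun i => hφ i n
  simpa using this.symm

open Filter Topology in
/-- Integration by parts in the `j`-th coordinate against a tensor product of bounded functions. -/
theorem tensorInt_update_eq_neg {β : Fin s → ℕ} {g w w' : (Fin s → ℝ) → ℝ} {j : Fin s}
    (hw : IsWeakMixedDeriv β g w) (hw' : IsWeakMixedDeriv (Function.update β j (β j + 1)) g w')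
    {M : ℝ} {h : Fin s → ℝ → ℝ} (hh : ∀ i, BddMeas M (h i)) {q : ℝ → ℝ} (hq : BddMeas M q)
    (hq0 : ∫ z, q z ∂unitVol = 0) :
    tensorInt w (Function.update h j q) = -tensorInt w' (Function.update h j (prim q)) := by
  choose φ hφ hφM hlim using fun i => (hh i).exists_testFun_tendsto
  obtain ⟨ψ, hψ, hψM, hψlim⟩ := hq.exists_testFun_tendsto
  obtain ⟨ρ, hρ, hρ1, R, hR⟩ := exists_testFun_integral_eq_one
  have hM0 := hq.nonneg
  have hR0 := hR.nonneg
  let c : ℕ → ℝ := fun n => ∫ z, ψ n z ∂unitVol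
  have hc : ∀ n, |c n| ≤ M := fun n =>
    abs_integral_le_integral_abs.trans (hψM n).abs_integral_le
  have hclim : Tendsto c atTop (𝓝 0) := by
    rw [← hq0]
    exact tendsto_integral_of_dominated_convergence (fun _ => M)
      (fun n => (hψM n).1.aestronglyMeasurable) (integrable_const _)
      (fun n => Eventually.of_forall (hψM n).2) hψlim
  -- Removing the mean with the unit-mass bump `ρ` makes the primitive of `θ n` a test function. The
  -- limit is unchanged, since `c n` tends to the mean of `q`, which is zero.
  let θ : ℕ → ℝ → ℝ := fun n z => ψ n z - c n * ρ z
  have hθ : ∀ n, TestFun (θ n) := fun n => (hψ n).sub_const_mul hρ (c n)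
  have hθM : ∀ n, BddMeas (M + M * R) (θ n) := by
    refine fun n => ⟨(hψM n).1.sub (hR.1.const_mul _), fun x => (abs_sub _ _).trans ?_⟩
    rw [abs_mul]
    exact add_le_add ((hψM n).2 x) (mul_le_mul (hc n) (hR.2 x) (abs_nonneg _) hM0)
  have hθ0 : ∀ n, ∫ z, θ n z ∂unitVol = 0 := by
    intro n
    rw [integral_sub (hψ n).integrable (hρ.integrable.const_mul _), integral_const_mul, hρ1,
      mul_one, sub_self]
  have hθlim : ∀ᵐ z ∂unitVol, Tendsto (fun n => θ n z) atTop (𝓝 (q z)) := by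
    filter_upwards [hψlim] with z hz
    simpa using hz.sub (hclim.mul_const (ρ z))
  have hMM : M ≤ M + M * R := le_add_of_nonneg_right (mul_nonneg hM0 hR0)
  have hplim : ∀ t, Tendsto (fun n => prim (θ n) t) atTop (𝓝 (prim q t)) := fun t =>
    tendsto_integral_of_dominated_convergence (fun _ => M + M * R)
      (fun n => (hθM n).1.aestronglyMeasurable) (integrable_const _)
      (fun n => Eventually.of_forall (hθM n).2) (ae_restrict_of_ae hθlim)
  have hupd : ∀ {k : ℕ → ℝ → ℝ} {r : ℝ → ℝ}, (∀ n, BddMeas (M + M * R) (k n)) →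
      (∀ᵐ z ∂unitVol, Tendsto (fun n => k n z) atTop (𝓝 (r z))) → ∀ f, IntegrableOn f (cube (Fin s)) →
      Tendsto (fun n => tensorInt f (Function.update (fun i => φ i n) j (k n))) atTop
        (𝓝 (tensorInt f (Function.update h j r))) := by
    intro k r hk hkr f hf
    refine tendsto_tensorInt hf (M := M + M * R) (fun n i => ?_) fun i => ?_
    · rcases eq_or_ne i j with rfl | hij
      · simpa using hk n
      · simpa [hij] using (hφM i n).mono hMM
    · rcases eq_or_ne i j with rfl | hij
      · simpa using hkr
      · simpa [hij] using hlim i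
  refine tendsto_nhds_unique (hupd hθM hθlim w hw.integrableOn_deriv) ?_
  refine (hupd (fun n => (bddMeas_prim (hθM n)).mono (hθM n).abs_integral_le)
    (Eventually.of_forall hplim) w' hw'.integrableOn_deriv).neg.congr fun n => ?_
  have h1 := tensorInt_update_deriv_of_testFun hw hw'
    (φ := Function.update (fun i => φ i n) j (prim (θ n))) fun i => by
      rcases eq_or_ne i j with rfl | hij
      · simpa using (hθ n).prim (hθ0 n)
      · simpa [hij] using hφ i n
  simp only [Function.update_self, Function.update_idem, (hθ n).deriv_prim] at h1
  exact h1.symm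

/-! ### Pairings controlled by the norm -/

theorem termNorm_le_familyNorm (p : ℝ≥0∞) (hp : 1 ≤ p) (α : ℕ)
    (D : (Fin s → ℕ) → (Fin s → ℝ) → ℝ) {u v : Finset (Fin s)} (hvu : v ⊆ u)
    (τ : ↥(u \ v) → ℕ) (hτ : ∀ j, τ j ∈ Finset.Icc 1 (α - 1)) :
    termNorm p α D u v τ ≤ familyNorm p α D := by
  have hv : v ∈ u.powerset := Finset.mem_powerset.2 hvu
  unfold familyNorm
  split_ifs with h
  · subst h
    exact le_iSup_of_le u (le_iSup₂_of_le v hv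
      (le_iSup₂_of_le τ (Fintype.mem_piFinset.2 hτ) le_rfl))
  · have hp0 : 0 < p.toReal := ENNReal.toReal_pos (zero_lt_one.trans_le hp).ne' h
    rw [one_div, ENNReal.le_rpow_inv_iff hp0]
    refine le_trans ?_ (Finset.single_le_sum (fun _ _ => zero_le) (Finset.mem_univ u))
    refine le_trans ?_ (Finset.single_le_sum (fun _ _ => zero_le) hv)
    refine le_trans ?_ (Finset.single_le_sum (a := τ) (fun _ _ => zero_le) ?_)
    · exact le_rfl
    · exact Fintype.mem_piFinset.2 hτ

theorem prod_mem_mul_prod_notMem (v : Finset (Fin s)) (f : Fin s → ℝ) :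
    (∏ i : {i // i ∈ v}, f i) * ∏ i : {i // ¬ i ∈ v}, f i = ∏ i, f i := by
  convert Fintype.prod_subtype_mul_prod_subtype (· ∈ v) f

theorem measurePreserving_piEquiv_symm (v : Finset (Fin s)) :
    MeasurePreserving (MeasurableEquiv.piEquivPiSubtypeProd (fun _ : Fin s => ℝ) (· ∈ v)).symm
      ((volume.restrict (cube {j : Fin s // j ∈ v})).prod
        (volume.restrict (cube {j : Fin s // ¬ j ∈ v})))
      (volume.restrict (cube (Fin s))) := by
  simp only [restrict_cube]
  convert (measurePreserving_piEquivPiSubtypeProd (fun _ : Fin s => unitVol) (· ∈ v)).symm <;> rfl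

theorem integrable_comp_piEquiv {f : (Fin s → ℝ) → ℝ} (hf : IntegrableOn f (cube (Fin s)))
    (v : Finset (Fin s)) :
    Integrable (fun z => f ((MeasurableEquiv.piEquivPiSubtypeProd (fun _ : Fin s => ℝ)
      (· ∈ v)).symm z)) ((volume.restrict (cube {j : Fin s // j ∈ v})).prod
        (volume.restrict (cube {j : Fin s // ¬ j ∈ v}))) :=
  (measurePreserving_piEquiv_symm v).integrable_comp_of_integrable hf

theorem integrable_integrateOut {f : (Fin s → ℝ) → ℝ} (hf : IntegrableOn f (cube (Fin s)))
    (v : Finset (Fin s)) : IntegrableOn (integrateOut v f) (cube {j : Fin s // j ∈ v}) :=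
  (integrable_comp_piEquiv hf v).integral_prod_left

theorem integrable_mul_prod {f : (Fin s → ℝ) → ℝ} (hf : IntegrableOn f (cube (Fin s)))
    {M : Fin s → ℝ} {h : Fin s → ℝ → ℝ} (hh : ∀ i, BddMeas (M i) (h i)) :
    IntegrableOn (fun z => f z * ∏ i, h i (z i)) (cube (Fin s)) := by
  refine Integrable.mul_bdd (c := ∏ i, M i) hf (Measurable.aestronglyMeasurable ?_)
    (Filter.Eventually.of_forall fun z => ?_)
  · exact Finset.measurable_fun_prod _ fun i _ => (hh i).1.comp (measurable_pi_apply i)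
  · rw [Real.norm_eq_abs, Finset.abs_prod]
    exact Finset.prod_le_prod (fun i _ => abs_nonneg _) fun i _ => (hh i).2 (z i)

/-- Constant factors leave the integral, and Fubini then integrates `f` over the coordinates outside
`v`. -/
theorem tensorInt_eq_integral_integrateOut {f : (Fin s → ℝ) → ℝ}
    (hf : IntegrableOn f (cube (Fin s))) {M : Fin s → ℝ} {h : Fin s → ℝ → ℝ}
    (hh : ∀ i, BddMeas (M i) (h i)) (v : Finset (Fin s)) {c : Fin s → ℝ}
    (hc : ∀ i ∉ v, h i = fun _ => c i) :
    tensorInt f h = (∏ i : {i // ¬ i ∈ v}, c i) *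
      ∫ x in cube {j : Fin s // j ∈ v}, (∏ i : {i // i ∈ v}, h i (x i)) * integrateOut v f x := by
  have hmp := measurePreserving_piEquiv_symm v
  set e := (MeasurableEquiv.piEquivPiSubtypeProd (fun _ : Fin s => ℝ) (· ∈ v)).symm with he
  have hprod : ∀ x y, ∏ i, h i (e (x, y) i) =
      (∏ i : {i // i ∈ v}, h i (x i)) * ∏ i : {i // ¬ i ∈ v}, c i := by
    intro x y
    rw [← prod_mem_mul_prod_notMem v]
    congr 1
    · refine Finset.prod_congr rfl fun i _ => ?_
      have : e (x, y) i = x i := by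
        change (if hi : (i : Fin s) ∈ v then x ⟨i, hi⟩ else y ⟨i, hi⟩) = x i
        rw [dif_pos i.2]
      rw [this]
    · exact Finset.prod_congr rfl fun i _ => by rw [hc i i.2]
  have hi := integrable_comp_piEquiv (integrable_mul_prod hf hh) v
  rw [tensorInt, ← hmp.integral_comp e.measurableEmbedding (fun z => f z * ∏ i, h i (z i)),
    integral_prod _ hi, ← integral_const_mul]
  refine integral_congr_ae (Filter.Eventually.of_forall fun x => ?_)
  simp only [← he, hprod, ← mul_assoc, integral_mul_const]
  rw [integrateOut]
  ring

theorem abs_tensorInt_le {f : (Fin s → ℝ) → ℝ} (hf : IntegrableOn f (cube (Fin s)))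
    {M : Fin s → ℝ} {h : Fin s → ℝ → ℝ} (hh : ∀ i, BddMeas (M i) (h i)) (v : Finset (Fin s))
    (hc : ∀ i ∉ v, ∃ c, h i = fun _ => c) :
    |tensorInt f h| ≤ (∏ i, M i) * ∫ x in cube {j : Fin s // j ∈ v}, |integrateOut v f x| := by
  have hc' : ∀ i ∉ v, h i = fun _ => h i 0 := by
    intro i hi
    obtain ⟨c, hc⟩ := hc i hi
    simp [hc]
  have hi := integrable_integrateOut hf v
  rw [tensorInt_eq_integral_integrateOut hf hh v hc', abs_mul,
    ← prod_mem_mul_prod_notMem v, mul_comm (∏ i : {i // i ∈ v}, M i), mul_assoc,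
    Finset.abs_prod, ← integral_const_mul]
  refine mul_le_mul (Finset.prod_le_prod (fun i _ => abs_nonneg _) fun i _ => (hh i).2 0) ?_
    (abs_nonneg _) (Finset.prod_nonneg fun i _ => (hh i).nonneg)
  refine abs_integral_le_integral_abs.trans
    (integral_mono_of_nonneg (Filter.Eventually.of_forall fun x => abs_nonneg _)
      (hi.abs.const_mul _) (Filter.Eventually.of_forall fun x => ?_))
  simp only [abs_mul, Finset.abs_prod]
  exact mul_le_mul_of_nonneg_right
    (Finset.prod_le_prod (fun i _ => abs_nonneg _) fun i _ => (hh i).2 (x i)) (abs_nonneg _)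

/-- The factors of a tensor product whose pairing with a mixed derivative is controlled by
`‖·‖_{p,α}`: constants where the order of differentiation is less than `α`, and bounded functions
where it is `α`. -/
def Admissible (α : ℕ) (M : ℝ) (t : ℕ) (f : ℝ → ℝ) : Prop :=
  (t < α ∧ ∃ c, |c| ≤ M ∧ f = fun _ => c) ∨ (t = α ∧ BddMeas M f)

theorem Admissible.le {α : ℕ} {M : ℝ} {t : ℕ} {f : ℝ → ℝ} (h : Admissible α M t f) : t ≤ α :=
  h.elim (fun h => h.1.le) fun h => h.1.le

theorem Admissible.bddMeas {α : ℕ} {M : ℝ} {t : ℕ} {f : ℝ → ℝ} (h : Admissible α M t f) :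
    BddMeas M f := by
  rcases h with ⟨_, c, hc, rfl⟩ | ⟨_, h⟩
  · exact (BddMeas.const c).mono hc
  · exact h

/-- The triple `(u, v, τ)` is read off from `β`; on a probability space the `L¹` norm is at most the
`L^p` norm. -/
theorem abs_tensorInt_le_familyNorm {p : ℝ≥0∞} (hp : 1 ≤ p) {α : ℕ} {g : (Fin s → ℝ) → ℝ}
    {D : (Fin s → ℕ) → (Fin s → ℝ) → ℝ} (hD : IsWeakMixedDerivFamily α g D)
    (hfin : familyNorm p α D < ∞) {M : Fin s → ℝ} {β : Fin s → ℕ} {h : Fin s → ℝ → ℝ}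
    (hh : ∀ i, Admissible α (M i) (β i) (h i)) :
    |tensorInt (D β) h| ≤ (∏ i, M i) * (familyNorm p α D).toReal := by
  have hf := (hD β fun i => (hh i).le).integrableOn_deriv
  let v : Finset (Fin s) := Finset.univ.filter fun i => β i = α
  -- The first alternative makes `v ⊆ u` immediate without any lower bound on `α`.
  let u : Finset (Fin s) := Finset.univ.filter fun i => β i = α ∨ β i ≠ 0
  let τ : ↥(u \ v) → ℕ := fun j => β j
  have hvu : v ⊆ u := fun i hi => by
    simp only [u, v, Finset.mem_filter, Finset.mem_univ, true_and] at hi ⊢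
    exact Or.inl hi
  have hτ : ∀ j, τ j ∈ Finset.Icc 1 (α - 1) := by
    rintro ⟨j, hj⟩
    have := (hh j).le
    simp only [u, v, Finset.mem_sdiff, Finset.mem_filter, Finset.mem_univ, true_and] at hj
    simp only [τ, Finset.mem_Icc]
    omega
  have hβ : derivOrder α u v τ = β := by
    funext j
    unfold derivOrder
    split_ifs with h1 h2
    · simp only [v, Finset.mem_filter, Finset.mem_univ, true_and] at h1
      exact h1.symm
    · rfl
    · simp only [u, v, Finset.mem_sdiff, Finset.mem_filter, Finset.mem_univ, true_and] at h1 h2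
      by_contra hne
      exact h2 ⟨Or.inr fun h => hne h.symm, h1⟩
  have hM : 0 ≤ ∏ i, M i := Finset.prod_nonneg fun i _ => (hh i).bddMeas.nonneg
  refine (abs_tensorInt_le hf (fun i => (hh i).bddMeas) v fun i hi => ?_).trans
    (mul_le_mul_of_nonneg_left ?_ hM)
  · rcases hh i with ⟨_, c, _, hc⟩ | ⟨h1, _⟩
    · exact ⟨c, hc⟩
    · exact absurd (by simp [v, h1]) hi
  · have hint := integrable_integrateOut hf v
    rw [← ENNReal.ofReal_le_iff_le_toReal hfin.ne]
    have hprob : IsProbabilityMeasure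
        ((volume : Measure ({j : Fin s // j ∈ v} → ℝ)).restrict (cube {j : Fin s // j ∈ v})) := by
      rw [restrict_cube]
      infer_instance
    calc ENNReal.ofReal (∫ x in cube {j : Fin s // j ∈ v}, |integrateOut v (D β) x|)
        = eLpNorm (integrateOut v (D β)) 1 (volume.restrict (cube {j : Fin s // j ∈ v})) := by
          rw [eLpNorm_one_eq_lintegral_enorm, ← ofReal_integral_norm_eq_lintegral_enorm hint]
          rfl
      _ ≤ eLpNorm (integrateOut v (D β)) p (volume.restrict (cube {j : Fin s // j ∈ v})) :=
          eLpNorm_le_eLpNorm_of_exponent_le hp hint.aestronglyMeasurable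
      _ = termNorm p α D u v τ := by rw [termNorm, hβ]
      _ ≤ familyNorm p α D := termNorm_le_familyNorm p hp α D hvu τ hτ

/-! ### Raising the order of differentiation to `α` -/

theorem exists_uniform_bddMeas {h : Fin s → ℝ → ℝ} (hh : ∀ i, ∃ M, BddMeas M (h i)) :
    ∃ M, ∀ i, BddMeas M (h i) := by
  choose M hM using hh
  exact ⟨∑ i, M i, fun i => (hM i).mono
    (Finset.single_le_sum (fun i _ => (hM i).nonneg) (Finset.mem_univ i))⟩

theorem bddMeas_update {M : ℝ} {h : Fin s → ℝ → ℝ} (hh : ∀ i, BddMeas M (h i)) (j : Fin s)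
    {f : ℝ → ℝ} {K : ℝ} (hf : BddMeas K f) :
    ∀ i, BddMeas (max M K) (Function.update h j f i) := by
  intro i
  rcases eq_or_ne i j with rfl | hij
  · simpa using hf.mono (le_max_right _ _)
  · simpa [hij] using (hh i).mono (le_max_left _ _)

theorem tensorInt_update_sub {f : (Fin s → ℝ) → ℝ} (hf : IntegrableOn f (cube (Fin s))) {M : ℝ}
    {h : Fin s → ℝ → ℝ} (hh : ∀ i, BddMeas M (h i)) (j : Fin s) {k l : ℝ → ℝ} {K L : ℝ}
    (hk : BddMeas K k) (hl : BddMeas L l) :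
    tensorInt f (Function.update h j fun x => k x - l x) =
      tensorInt f (Function.update h j k) - tensorInt f (Function.update h j l) := by
  rw [tensorInt, tensorInt, tensorInt, ← integral_sub (integrable_mul_prod hf (bddMeas_update hh j hk))
    (integrable_mul_prod hf (bddMeas_update hh j hl))]
  refine integral_congr_ae (Filter.Eventually.of_forall fun z => ?_)
  have hu : ∀ q : ℝ → ℝ, ∏ i, Function.update h j q i (z i) =
      q (z j) * ∏ i ∈ Finset.univ.erase j, h i (z i) := by
    intro q
    rw [← Finset.mul_prod_erase _ _ (Finset.mem_univ j), Function.update_self]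
    congr 1
    exact Finset.prod_congr rfl fun i hi => by
      rw [Function.update_of_ne (Finset.ne_of_mem_erase hi)]
  simp only [hu]
  ring

section Reduction

variable {α : ℕ} {g : (Fin s → ℝ) → ℝ} {D : (Fin s → ℕ) → (Fin s → ℝ) → ℝ}

/-- Split `f` into its mean `c` and `f - c`, and integrate the latter by parts; `F` is the primitive
of `f - c`. The factor `2` comes from `‖f - c‖₁ ≤ 2 ‖f‖₁`. -/
theorem exists_tensorInt_eq_sub (hD : IsWeakMixedDerivFamily α g D) {β : Fin s → ℕ}
    (hβ : ∀ i, β i ≤ α) {M : ℝ} {h : Fin s → ℝ → ℝ} (hh : ∀ i, BddMeas M (h i)) (j : Fin s)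
    {t : ℕ} (ht : t < α) {f : ℝ → ℝ} {K : ℝ} (hf : BddMeas K f) :
    ∃ c F, |c| ≤ ∫ z, |f z| ∂unitVol ∧ BddMeas (2 * ∫ z, |f z| ∂unitVol) F ∧
      tensorInt (D (Function.update β j t)) (Function.update h j f) =
        tensorInt (D (Function.update β j t)) (Function.update h j fun _ => c) -
          tensorInt (D (Function.update β j (t + 1))) (Function.update h j F) := by
  set c := ∫ z, f z ∂unitVol with hc
  have hupd : ∀ r ≤ α, ∀ i, Function.update β j r i ≤ α := by
    intro r hr i
    rcases eq_or_ne i j with rfl | hij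
    · simpa using hr
    · simpa [hij] using hβ i
  have hw := hD _ (hupd t ht.le)
  have hw' : IsWeakMixedDeriv (Function.update (Function.update β j t) j
      (Function.update β j t j + 1)) g (D (Function.update β j (t + 1))) := by
    rw [Function.update_self, Function.update_idem]
    exact hD _ (hupd (t + 1) ht)
  have hcle : |c| ≤ ∫ z, |f z| ∂unitVol := abs_integral_le_integral_abs
  have hq : BddMeas (K + |c|) (fun x => f x - c) := hf.sub (BddMeas.const c)
  have hq0 : ∫ z, (f z - c) ∂unitVol = 0 := by
    rw [integral_sub hf.integrable (integrable_const _), ← hc]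
    simp
  have hqle : ∫ z, |f z - c| ∂unitVol ≤ 2 * ∫ z, |f z| ∂unitVol := by
    calc ∫ z, |f z - c| ∂unitVol ≤ ∫ z, (|f z| + |c|) ∂unitVol :=
          integral_mono hq.integrable.abs (hf.integrable.abs.add (integrable_const _))
            fun z => abs_sub _ _
      _ = (∫ z, |f z| ∂unitVol) + |c| := by
          rw [integral_add hf.integrable.abs (integrable_const _)]
          simp
      _ ≤ _ := by linarith
  refine ⟨c, prim fun x => f x - c, hcle, (bddMeas_prim hq).mono hqle, ?_⟩
  have h1 := tensorInt_update_eq_neg hw hw' (M := max M (K + |c|))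
    (fun i => (hh i).mono (le_max_left _ _)) (hq.mono (le_max_right _ _)) hq0
  rw [tensorInt_update_sub hw.integrableOn_deriv hh j hf (BddMeas.const c)] at h1
  linarith

/-- Each of the `r` steps leaves one constant term and at most doubles the bound of the remaining
factor; with the final term of order `α` this makes `r + 1` terms. -/
theorem abs_tensorInt_update_le_of_bddMeas (hD : IsWeakMixedDerivFamily α g D) {β : Fin s → ℕ}
    (hβ : ∀ i, β i ≤ α) {K : ℝ} {h : Fin s → ℝ → ℝ} (hh : ∀ i, BddMeas K (h i)) (j : Fin s)
    {M T : ℝ} (hT : ∀ t f, Admissible α M t f →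
      |tensorInt (D (Function.update β j t)) (Function.update h j f)| ≤ T) (r : ℕ) :
    ∀ (t : ℕ) (f : ℝ → ℝ) (N : ℝ), t + r = α → BddMeas N f → 2 ^ r * N ≤ M →
      |tensorInt (D (Function.update β j t)) (Function.update h j f)| ≤ (r + 1) * T := by
  induction r with
  | zero =>
    intro t f N ht hf hN
    simpa using hT t f (Or.inr ⟨ht, hf.mono (by simpa using hN)⟩)
  | succ r ih =>
    intro t f N ht hf hN
    obtain ⟨c, F, hc, hF, heq⟩ := exists_tensorInt_eq_sub hD hβ hh j (by omega : t < α) hf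
    have hfN := hf.abs_integral_le
    have h1 := hT t (fun _ => c) (Or.inl ⟨by omega, c, ?_, rfl⟩)
    · have h2 := ih (t + 1) F (2 * N) (by omega) (hF.mono (by linarith)) (by
        rw [pow_succ] at hN; linarith)
      rw [heq]
      refine (abs_sub _ _).trans ?_
      push_cast
      linarith
    · have : (1 : ℝ) ≤ 2 ^ (r + 1) := one_le_pow₀ (by norm_num)
      nlinarith [hf.nonneg]

/-- The kernel has mean zero, so the first step leaves no constant and yields the gain `2 b⁻ᵃ` in
`L¹`. The second leaves a constant of that size and a factor bounded by `4 b⁻ᵃ`; doubling up to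
order `α` reaches `2^α b⁻ᵃ`. In all, `α` terms remain. -/
theorem abs_tensorInt_levelKernel_le (hα : 2 ≤ α) (hD : IsWeakMixedDerivFamily α g D)
    {β : Fin s → ℕ} (hβ : ∀ i, β i ≤ α) {K : ℝ} {h : Fin s → ℝ → ℝ} (hh : ∀ i, BddMeas K (h i))
    (j : Fin s) {b a : ℕ} (hb : 2 ≤ b) {x : ℝ} (hx : x ∈ Set.Ico (0 : ℝ) 1) (hβj : β j = 0)
    (hhj : h j = levelKernel b (a + 1) x) {M T : ℝ} (hM : 2 ^ α * ((b : ℝ) ^ a)⁻¹ ≤ M)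
    (hT : ∀ t f, Admissible α M t f →
      |tensorInt (D (Function.update β j t)) (Function.update h j f)| ≤ T) :
    |tensorInt (D β) h| ≤ α * T := by
  have hb0 : 0 < ((b : ℝ) ^ a)⁻¹ := by
    have : (0 : ℝ) < b := by exact_mod_cast (by omega : 0 < b)
    positivity
  obtain ⟨L, hL⟩ := bddMeas_levelKernel b (a + 1) x
  obtain ⟨r, rfl⟩ := Nat.exists_eq_add_of_le hα
  have h0 : tensorInt (D β) h = -tensorInt (D (Function.update β j 1))
      (Function.update h j (prim (levelKernel b (a + 1) x))) := by
    have hw' : IsWeakMixedDeriv (Function.update β j (β j + 1)) g (D (Function.update β j 1)) := by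
      rw [hβj]
      refine hD _ fun i => ?_
      rcases eq_or_ne i j with rfl | hij
      · simp
        omega
      · simpa [hij] using hβ i
    have := tensorInt_update_eq_neg (hD β hβ) hw' (M := max K L)
      (fun i => (hh i).mono (le_max_left _ _)) (hL.mono (le_max_right _ _))
      (integral_levelKernel_succ hb hx)
    rwa [← hhj, Function.update_eq_self, hhj] at this
  have hPle := integral_abs_prim_levelKernel_succ_le (a := a) hb hx
  obtain ⟨c, F, hc, hF, heq⟩ := exists_tensorInt_eq_sub hD hβ hh j (by omega : 1 < 2 + r)
    (bddMeas_prim hL)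
  have hpow : (1 : ℝ) ≤ 2 ^ r := one_le_pow₀ (by norm_num)
  have hexp : (2 : ℝ) ^ (2 + r) = 4 * 2 ^ r := by rw [pow_add]; norm_num
  rw [hexp] at hM
  have h1 := hT 1 (fun _ => c) (Or.inl ⟨by omega, c, by nlinarith, rfl⟩)
  have h2 := abs_tensorInt_update_le_of_bddMeas hD hβ hh j hT r 2 F _ rfl
    (hF.mono (by linarith : _ ≤ 4 * ((b : ℝ) ^ a)⁻¹)) (by linarith)
  rw [h0, abs_neg, heq]
  refine (abs_sub _ _).trans ?_
  push_cast
  linarith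

/-- The bound on the pairing with a tensor product of level kernels of the levels `a j`. -/
theorem abs_tensorInt_levelKernels_le {p : ℝ≥0∞} (hp : 1 ≤ p) (hα : 2 ≤ α)
    (hD : IsWeakMixedDerivFamily α g D) (hfin : familyNorm p α D < ∞) {b : ℕ} (hb : 2 ≤ b)
    (a : Fin s → ℕ) {x : Fin s → ℝ} (hx : ∀ i, x i ∈ Set.Ico (0 : ℝ) 1) :
    |tensorInt (D 0) (fun i => levelKernel b (a i) (x i))| ≤
      (α * (2 ^ α * b)) ^ s * ((b : ℝ) ^ ∑ i, a i)⁻¹ * (familyNorm p α D).toReal := by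
  have hb0 : (0 : ℝ) < b := by exact_mod_cast (by omega : 0 < b)
  set M : Fin s → ℝ := fun i => 2 ^ α * b * ((b : ℝ) ^ a i)⁻¹ with hMdef
  set B : ℝ := (∏ i, M i) * (familyNorm p α D).toReal with hB
  have hB0 : 0 ≤ B := mul_nonneg (Finset.prod_nonneg fun i _ => by positivity) ENNReal.toReal_nonneg
  -- `A` holds the coordinates not yet reduced, which still carry order zero and their level
  -- kernels.
  have key : ∀ (A : Finset (Fin s)) (β : Fin s → ℕ) (h : Fin s → ℝ → ℝ),
      (∀ i ∈ A, β i = 0 ∧ h i = levelKernel b (a i) (x i)) →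
      (∀ i ∉ A, Admissible α (M i) (β i) (h i)) → |tensorInt (D β) h| ≤ α ^ A.card * B := by
    intro A
    induction A using Finset.induction_on with
    | empty =>
      intro β h _ hh
      simpa using abs_tensorInt_le_familyNorm hp hD hfin fun i => hh i (Finset.notMem_empty i)
    | insert j A hj ih =>
      intro β h h1 h2
      have hβ : ∀ i, β i ≤ α := fun i => by
        by_cases hi : i ∈ insert j A
        · rw [(h1 i hi).1]; omega
        · exact (h2 i hi).le
      obtain ⟨K, hK⟩ := exists_uniform_bddMeas (h := h) fun i => by
        by_cases hi : i ∈ insert j A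
        · rw [(h1 i hi).2]; exact bddMeas_levelKernel _ _ _
        · exact ⟨_, (h2 i hi).bddMeas⟩
      have hT : ∀ t f, Admissible α (M j) t f →
          |tensorInt (D (Function.update β j t)) (Function.update h j f)| ≤ α ^ A.card * B := by
        intro t f htf
        refine ih _ _ (fun i hi => ?_) fun i hi => ?_
        · have hij : i ≠ j := fun h => hj (h ▸ hi)
          simpa [hij] using h1 i (Finset.mem_insert_of_mem hi)
        · rcases eq_or_ne i j with rfl | hij
          · simpa using htf
          · simpa [hij] using h2 i (by simp [hij, hi])
      obtain ⟨hβj, hhj⟩ := h1 j (Finset.mem_insert_self j A)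
      rw [Finset.card_insert_of_notMem hj, pow_succ', mul_assoc]
      rcases hcase : a j with _ | a'
      -- The kernel of level zero is the constant `1`, already admissible at order zero as `M j ≥
      -- 1`; the factor `α` is wasted here.
      · have hadm : Admissible α (M j) (β j) (h j) := by
          refine Or.inl ⟨by omega, 1, ?_, ?_⟩
          · have h2a : (1 : ℝ) ≤ 2 ^ α := one_le_pow₀ (by norm_num)
            have hb1 : (1 : ℝ) ≤ b := by exact_mod_cast (by omega : 1 ≤ b)
            simp only [hMdef, hcase, pow_zero, inv_one, mul_one, abs_one]
            nlinarith
          · rw [hhj, hcase]; rfl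
        have := hT _ _ hadm
        rw [Function.update_eq_self, Function.update_eq_self] at this
        refine this.trans (le_mul_of_one_le_left (by positivity) ?_)
        exact_mod_cast (by omega : 1 ≤ α)
      · refine abs_tensorInt_levelKernel_le hα hD hβ hK j hb (hx j) hβj (by rw [hhj, hcase])
          (le_of_eq ?_) hT
        simp only [hMdef, hcase, pow_succ]
        field_simp
  have h := key Finset.univ 0 (fun i => levelKernel b (a i) (x i)) (fun i _ => ⟨rfl, rfl⟩)
    fun i hi => absurd (Finset.mem_univ i) hi
  refine h.trans (le_of_eq ?_)
  rw [hB, hMdef, Finset.prod_mul_distrib, Finset.prod_inv_distrib, Finset.prod_pow_eq_pow_sum]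
  simp [mul_pow]
  ring

end Reduction

/-! ### Walsh partial sums as pairings -/

theorem measurable_walsh₁ (b k : ℕ) : Measurable (walsh₁ b k) := by
  have : Measurable fun x : ℝ => ∑ i ∈ Finset.range (Nat.digits b k).length,
      (k / b ^ i % b) * (⌊x * (b : ℝ) ^ (i + 1)⌋₊ % b) := by
    refine Finset.measurable_fun_sum _ fun i _ => Measurable.const_mul ?_ _
    exact (Measurable.of_discrete (f := fun m : ℕ => m % b)).comp
      (Nat.measurable_floor.comp (measurable_id.mul_const _))
  exact Complex.measurable_exp.comp
    (((Measurable.of_discrete (f := fun m : ℕ => (m : ℂ))).comp this).const_mul _)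

theorem norm_walsh₁ (b k : ℕ) (x : ℝ) : ‖walsh₁ b k x‖ = 1 := by
  rw [walsh₁, Complex.norm_exp]
  set N := ∑ i ∈ Finset.range (Nat.digits b k).length,
      (k / b ^ i % b) * (⌊x * (b : ℝ) ^ (i + 1)⌋₊ % b)
  have : (2 * Real.pi * Complex.I / b * (N : ℂ)) =
      ((2 * Real.pi / b * N : ℝ) : ℂ) * Complex.I := by
    push_cast
    ring
  rw [this, Complex.re_ofReal_mul, Complex.I_re, mul_zero, Real.exp_zero]

theorem integrable_mul_conj_walsh {g : (Fin s → ℝ) → ℝ} (hg : IntegrableOn g (cube (Fin s)))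
    (b : ℕ) (k : Fin s → ℕ) :
    IntegrableOn (fun z => (g z : ℂ) * conj (walsh b k z)) (cube (Fin s)) := by
  refine Integrable.mul_bdd (c := 1) hg.ofReal (Measurable.aestronglyMeasurable ?_)
    (Filter.Eventually.of_forall fun z => ?_)
  · refine Complex.continuous_conj.measurable.comp ?_
    exact Finset.measurable_fun_prod _ fun i _ =>
      (measurable_walsh₁ b (k i)).comp (measurable_pi_apply i)
  · rw [RCLike.norm_conj, walsh, norm_prod]
    simp [norm_walsh₁]

theorem ae_cube_mem_Ico : ∀ᵐ z ∂(volume : Measure (Fin s → ℝ)).restrict (cube (Fin s)),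
    ∀ i, z i ∈ Set.Ico (0 : ℝ) 1 :=
  ae_cube_of_ae_unitVol fun _ => ae_unitVol_mem

/-- A Walsh partial sum over a product set is the pairing with the product of the one-dimensional
kernels. -/
theorem walshPartial_piFinset {g : (Fin s → ℝ) → ℝ} (hg : IntegrableOn g (cube (Fin s))) (b : ℕ)
    (S : Fin s → Finset ℕ) (x : Fin s → ℝ) {κ : Fin s → ℝ → ℝ}
    (hκ : ∀ i, ∀ z ∈ Set.Ico (0 : ℝ) 1,
      ∑ k ∈ S i, walsh₁ b k (x i) * conj (walsh₁ b k z) = (κ i z : ℂ)) :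
    walshPartial b (Fintype.piFinset S) g x = (tensorInt g κ : ℂ) := by
  simp only [walshPartial, walshCoeff, ← integral_mul_const]
  rw [← integral_finsetSum _ fun k _ => (integrable_mul_conj_walsh hg b k).mul_const _, tensorInt,
    ← integral_complex_ofReal]
  refine integral_congr_ae ?_
  filter_upwards [ae_cube_mem_Ico] with z hz
  push_cast
  rw [Finset.prod_congr rfl fun i _ => (hκ i (z i) (hz i)).symm, Finset.prod_univ_sum,
    Finset.mul_sum]
  refine Finset.sum_congr rfl fun k _ => ?_
  rw [Finset.prod_mul_distrib, walsh, walsh, map_prod]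
  ring

/-! ### Levels of frequencies -/

/-- The natural numbers with exactly `a` digits in base `b`. -/
def level (b a : ℕ) : Finset ℕ :=
  (Finset.range (b ^ a)).filter fun k => (Nat.digits b k).length = a

theorem mem_level {b : ℕ} (hb : 2 ≤ b) {a k : ℕ} :
    k ∈ level b a ↔ (Nat.digits b k).length = a := by
  rw [level, Finset.mem_filter, Finset.mem_range, ← Nat.digits_length_le_iff (by omega)]
  omega

theorem floor_eq_floor {x z : ℝ} (hx : x ∈ Set.Ico (0 : ℝ) 1) (hz : z ∈ Set.Ico (0 : ℝ) 1) :
    ⌊x⌋₊ = ⌊z⌋₊ := by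
  rw [Nat.floor_eq_zero.2 hx.2, Nat.floor_eq_zero.2 hz.2]

theorem sum_range_walsh₁ {b : ℕ} (hb : 2 ≤ b) (n : ℕ) {x z : ℝ} (hx : x ∈ Set.Ico (0 : ℝ) 1)
    (hz : z ∈ Set.Ico (0 : ℝ) 1) :
    ∑ k ∈ Finset.range (b ^ n), walsh₁ b k x * conj (walsh₁ b k z) =
      (cellKernel b n x z : ℂ) := by
  rw [sum_walsh₁_mul_conj hb (floor_eq_floor hx hz), cellKernel]
  split_ifs <;> simp

theorem sum_level_walsh₁ {b : ℕ} (hb : 2 ≤ b) (a : ℕ) {x z : ℝ} (hx : x ∈ Set.Ico (0 : ℝ) 1)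
    (hz : z ∈ Set.Ico (0 : ℝ) 1) :
    ∑ k ∈ level b a, walsh₁ b k x * conj (walsh₁ b k z) = (levelKernel b a x z : ℂ) := by
  cases a with
  | zero =>
    have : level b 0 = {0} := by
      ext k
      simp [level]
      intro h
      simp [h]
    rw [this, Finset.sum_singleton]
    simp [walsh₁, levelKernel]
  | succ a =>
    have hsub : Finset.range (b ^ a) ⊆ Finset.range (b ^ (a + 1)) :=
      Finset.range_mono (Nat.pow_le_pow_right (by omega) (by omega))
    have : level b (a + 1) = Finset.range (b ^ (a + 1)) \ Finset.range (b ^ a) := by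
      ext k
      rw [mem_level hb, Finset.mem_sdiff, Finset.mem_range, Finset.mem_range,
        ← Nat.digits_length_le_iff (by omega), ← Nat.digits_length_le_iff (by omega)]
      omega
    rw [this, Finset.sum_sdiff_eq_sub hsub, sum_range_walsh₁ hb _ hx hz, sum_range_walsh₁ hb _ hx hz,
      levelKernel]
    push_cast
    rfl

theorem mem_boxIndex {b : ℕ} (hb : 2 ≤ b) {d k : Fin s → ℕ} :
    k ∈ boxIndex b d ↔ ∀ j, (Nat.digits b (k j)).length ≤ d j := by
  simp only [boxIndex, Fintype.mem_piFinset, Finset.mem_range, Nat.digits_length_le_iff hb]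

theorem mem_crossIndex (hs : 1 ≤ s) {b : ℕ} (hb : 2 ≤ b) {ν : ℕ} {k : Fin s → ℕ} :
    k ∈ crossIndex s b ν ↔ ∑ j, (Nat.digits b (k j)).length ≤ ν := by
  simp only [crossIndex, Finset.mem_biUnion, Finset.mem_piAntidiag, mem_boxIndex hb]
  constructor
  · rintro ⟨d, ⟨hd, -⟩, hk⟩
    rw [← hd]
    exact Finset.sum_le_sum fun j _ => hk j
  · intro h
    obtain ⟨r, hr⟩ := Nat.exists_eq_add_of_le h
    -- The slack `r` goes into the first coordinate, which exists because `s ≥ 1`.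
    refine ⟨fun j => (Nat.digits b (k j)).length + if j = ⟨0, hs⟩ then r else 0,
      ⟨?_, by simp⟩, fun j => Nat.le_add_right _ _⟩
    rw [Finset.sum_add_distrib, hr]
    simp

/-- The frequencies of the box outside `K_ν` are grouped by their vector of digit lengths; each
fibre is a full product of levels. -/
theorem walshPartial_box_sub_cross (hs : 1 ≤ s) {b : ℕ} (hb : 2 ≤ b) {ν n : ℕ} (hn : ν ≤ n)
    (g : (Fin s → ℝ) → ℝ) (x : Fin s → ℝ) :
    walshPartial b (boxIndex b fun _ => n) g x - walshPartial b (crossIndex s b ν) g x =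
      ∑ a ∈ (Fintype.piFinset fun _ : Fin s => Finset.range (n + 1)).filter (ν < ∑ j, · j),
        walshPartial b (Fintype.piFinset fun j => level b (a j)) g x := by
  have hsub : crossIndex s b ν ⊆ boxIndex b fun _ => n := by
    intro k hk
    rw [mem_crossIndex hs hb] at hk
    rw [mem_boxIndex hb]
    exact fun j => (Finset.single_le_sum (f := fun j => (Nat.digits b (k j)).length)
      (fun _ _ => Nat.zero_le _) (Finset.mem_univ j)).trans (hk.trans hn)
  have hmaps : ∀ k ∈ (boxIndex b fun _ : Fin s => n) \ crossIndex s b ν,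
      (fun j => (Nat.digits b (k j)).length) ∈
        (Fintype.piFinset fun _ : Fin s => Finset.range (n + 1)).filter (ν < ∑ j, · j) := by
    intro k hk
    rw [Finset.mem_sdiff, mem_boxIndex hb, mem_crossIndex hs hb] at hk
    simp only [Finset.mem_filter, Fintype.mem_piFinset, Finset.mem_range]
    exact ⟨fun j => Nat.lt_succ_of_le (hk.1 j), not_le.1 hk.2⟩
  unfold walshPartial
  rw [← Finset.sum_sdiff_eq_sub hsub, ← Finset.sum_fiberwise_of_maps_to hmaps]
  refine Finset.sum_congr rfl fun a ha => Finset.sum_congr ?_ fun _ _ => rfl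
  simp only [Finset.mem_filter, Fintype.mem_piFinset, Finset.mem_range] at ha
  ext k
  simp only [Finset.mem_filter, Finset.mem_sdiff, mem_boxIndex hb, mem_crossIndex hs hb,
    Fintype.mem_piFinset, mem_level hb, funext_iff]
  constructor
  · exact fun h => h.2
  · intro h
    refine ⟨⟨fun j => ?_, ?_⟩, h⟩
    · rw [h j]; exact Nat.le_of_lt_succ (ha.1 j)
    · simp only [h]; exact not_le.2 ha.2

/-! ### Summation over the levels beyond `ν` -/

/-- The constant in the bound of the tail of a sum over level vectors. -/
def tailConst (s b : ℕ) : ℝ := (b : ℝ) ^ 2 * ∑' l : ℕ, ((l + 3 : ℕ) : ℝ) ^ s * (b : ℝ)⁻¹ ^ (l + 3)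

theorem summable_tailConst (s : ℕ) {b : ℕ} (hb : 2 ≤ b) :
    Summable fun l : ℕ => ((l + 3 : ℕ) : ℝ) ^ s * (b : ℝ)⁻¹ ^ (l + 3) := by
  have hb2 : (2 : ℝ) ≤ b := by exact_mod_cast hb
  have h : ‖(b : ℝ)⁻¹‖ < 1 := by
    rw [norm_inv, Real.norm_of_nonneg (by linarith)]
    exact inv_lt_one_of_one_lt₀ (by linarith)
  have := (summable_nat_add_iff (f := fun n : ℕ => (n : ℝ) ^ s * (b : ℝ)⁻¹ ^ n) 3).2
    (summable_pow_mul_geometric_of_norm_lt_one s h)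
  exact this

theorem tailConst_nonneg (s b : ℕ) : 0 ≤ tailConst s b :=
  mul_nonneg (by positivity) (tsum_nonneg fun l => by positivity)

theorem sum_level_tail_le {b : ℕ} (hb : 2 ≤ b) {ν : ℕ} (hν : 1 ≤ ν) (n : ℕ) :
    ∑ a ∈ (Fintype.piFinset fun _ : Fin s => Finset.range (n + 1)).filter (ν < ∑ j, · j),
        ((b : ℝ) ^ ∑ j, a j)⁻¹ ≤ tailConst s b * (ν : ℝ) ^ s * ((b : ℝ) ^ ν)⁻¹ := by
  have hb0 : (0 : ℝ) < b := by exact_mod_cast (by omega : 0 < b)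
  set A := (Fintype.piFinset fun _ : Fin s => Finset.range (n + 1)).filter (ν < ∑ j, · j) with hA
  have hAmem : ∀ a ∈ A, (∀ j, a j < n + 1) ∧ ν < ∑ j, a j := fun a ha => by
    simpa [hA] using ha
  have hmaps : ∀ a ∈ A, ∑ j, a j - ν - 1 ∈ Finset.range (s * n + 1) := by
    intro a ha
    have h1 : ∑ j, a j ≤ s * n := by
      calc ∑ j, a j ≤ ∑ _j : Fin s, n :=
            Finset.sum_le_sum fun j _ => Nat.le_of_lt_succ ((hAmem a ha).1 j)
        _ = s * n := by simp
    rw [Finset.mem_range]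
    omega
  rw [← Finset.sum_fiberwise_of_maps_to hmaps]
  have hfib : ∀ l ∈ Finset.range (s * n + 1),
      ∑ a ∈ A.filter (fun a => ∑ j, a j - ν - 1 = l), ((b : ℝ) ^ ∑ j, a j)⁻¹ ≤
        (b : ℝ) ^ 2 * ((ν : ℝ) ^ s * ((b : ℝ) ^ ν)⁻¹) *
          (((l + 3 : ℕ) : ℝ) ^ s * (b : ℝ)⁻¹ ^ (l + 3)) := by
    intro l _
    have hsum : ∀ a ∈ A.filter (fun a => ∑ j, a j - ν - 1 = l), ∑ j, a j = ν + 1 + l := by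
      intro a ha
      obtain ⟨ha, hl⟩ := Finset.mem_filter.1 ha
      have := (hAmem a ha).2
      omega
    -- Each entry is at most `ν + 1 + l`, which is less than `ν (l + 3)` because `ν ≥ 1`; this
    -- separates `ν` from `l`.
    have hcard : (A.filter (fun a => ∑ j, a j - ν - 1 = l)).card ≤ (ν * (l + 3)) ^ s := by
      calc (A.filter (fun a => ∑ j, a j - ν - 1 = l)).card
          ≤ (Fintype.piFinset fun _ : Fin s => Finset.range (ν * (l + 3))).card := by
            refine Finset.card_le_card fun a ha => ?_
            rw [Fintype.mem_piFinset]
            intro j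
            have h1 := hsum a ha
            have h2 := Finset.single_le_sum (f := a) (fun _ _ => Nat.zero_le _) (Finset.mem_univ j)
            rw [Finset.mem_range]
            nlinarith
        _ = (ν * (l + 3)) ^ s := by simp
    rw [Finset.sum_congr rfl fun a ha => by rw [hsum a ha], Finset.sum_const, nsmul_eq_mul]
    calc ((A.filter (fun a => ∑ j, a j - ν - 1 = l)).card : ℝ) * ((b : ℝ) ^ (ν + 1 + l))⁻¹
        ≤ (((ν * (l + 3)) ^ s : ℕ) : ℝ) * ((b : ℝ) ^ (ν + 1 + l))⁻¹ := by
          refine mul_le_mul_of_nonneg_right ?_ (by positivity)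
          exact_mod_cast hcard
      -- The factor `b²` compensates for writing `b^(-(ν + 1 + l))` with the exponent `l + 3`.
      _ = _ := by
          push_cast
          simp only [pow_add, inv_pow, mul_pow]
          field_simp
  refine (Finset.sum_le_sum hfib).trans ?_
  rw [← Finset.mul_sum, tailConst]
  have h := (summable_tailConst s hb).sum_le_tsum (Finset.range (s * n + 1))
    fun l _ => by positivity
  calc _ ≤ (b : ℝ) ^ 2 * ((ν : ℝ) ^ s * ((b : ℝ) ^ ν)⁻¹) *
        ∑' l : ℕ, ((l + 3 : ℕ) : ℝ) ^ s * (b : ℝ)⁻¹ ^ (l + 3) :=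
        mul_le_mul_of_nonneg_left h (by positivity)
    _ = _ := by ring

/-! ### Almost everywhere convergence of the box partial sums -/

/-- In the sup metric a closed `b`-adic cube is a closed ball, so the pairing takes the form
required for Lebesgue differentiation; half-open and closed cubes differ by a null set. -/
theorem tensorInt_cellKernel {b : ℕ} (hb : 2 ≤ b) (g : (Fin s → ℝ) → ℝ) (n : ℕ) {x : Fin s → ℝ}
    (hx : ∀ i, x i ∈ Set.Ico (0 : ℝ) 1) :
    tensorInt g (fun i => cellKernel b n (x i)) =
      ⨍ z in Metric.closedBall (fun i => (⌊x i * (b : ℝ) ^ n⌋₊ + 1 / 2) / (b : ℝ) ^ n)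
        (1 / 2 / (b : ℝ) ^ n), (cube (Fin s)).indicator g z := by
  classical
  have hb0 : (0 : ℝ) < (b : ℝ) ^ n := by
    have : (0 : ℝ) < b := by exact_mod_cast (by omega : 0 < b)
    positivity
  set m : Fin s → ℕ := fun i => ⌊x i * (b : ℝ) ^ n⌋₊ with hm
  set lo : Fin s → ℝ := fun i => m i / (b : ℝ) ^ n with hlo
  set hi : Fin s → ℝ := fun i => (m i + 1) / (b : ℝ) ^ n with hhi
  have hball : Metric.closedBall (fun i => ((m i : ℝ) + 1 / 2) / (b : ℝ) ^ n)
      (1 / 2 / (b : ℝ) ^ n) = Set.Icc lo hi := by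
    rw [closedBall_pi _ (by positivity), ← Set.pi_univ_Icc]
    congr 1
    funext i
    rw [Real.closedBall_eq_Icc]
    congr 1
    · simp only [hlo]; ring
    · simp only [hhi]; ring
  have hvol : volume.real (Set.Icc lo hi) = (((b : ℝ) ^ n) ^ s)⁻¹ := by
    rw [Measure.real, Real.volume_Icc_pi_toReal]
    · have : ∀ i, hi i - lo i = ((b : ℝ) ^ n)⁻¹ := fun i => by simp only [hlo, hhi]; ring
      simp [this]
    · exact fun i => by simp only [hlo, hhi]; gcongr; linarith
  have hcell : Set.univ.pi (fun i => cell b n (m i)) ⊆ cube (Fin s) := by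
    rw [cube, ← Set.pi_univ_Icc]
    exact Set.pi_mono fun i _ => cell_subset hb (hx i)
  have hcube : MeasurableSet (cube (Fin s)) := measurableSet_Icc
  rw [hball, setAverage_eq, hvol, inv_inv, smul_eq_mul]
  have hae : Set.univ.pi (fun i => cell b n (m i)) =ᵐ[volume] Set.Icc lo hi :=
    Measure.univ_pi_Ico_ae_eq_Icc
  rw [← setIntegral_congr_set hae, setIntegral_indicator hcube,
    Set.inter_eq_left.2 hcell, ← integral_const_mul,
    ← Set.inter_eq_right.2 hcell, ← setIntegral_indicator
      (MeasurableSet.univ_pi fun i => measurableSet_cell), tensorInt]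
  refine integral_congr_ae ?_
  filter_upwards [ae_cube_mem_Ico] with z hz
  by_cases hzc : z ∈ Set.univ.pi (fun i => cell b n (m i))
  · rw [Set.indicator_of_mem hzc]
    have : ∀ i, cellKernel b n (x i) (z i) = (b : ℝ) ^ n := fun i => by
      rw [cellKernel_eq_indicator hb _ (hz i).1, Set.indicator_of_mem (hzc i (Set.mem_univ i))]
    simp [this, mul_comm]
  · rw [Set.indicator_of_notMem hzc]
    obtain ⟨i, hi⟩ : ∃ i, z i ∉ cell b n (m i) := by
      by_contra! h
      exact hzc fun i _ => h i
    rw [Finset.prod_eq_zero (Finset.mem_univ i), mul_zero]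
    rw [cellKernel_eq_indicator hb _ (hz i).1, Set.indicator_of_notMem hi]

open Filter Topology in
theorem ae_tendsto_tensorInt_cellKernel {b : ℕ} (hb : 2 ≤ b) {g : (Fin s → ℝ) → ℝ}
    (hg : IntegrableOn g (cube (Fin s))) :
    ∀ᵐ x ∂volume.restrict (cube (Fin s)),
      Tendsto (fun n => tensorInt g (fun i => cellKernel b n (x i))) atTop (𝓝 (g x)) := by
  have hb1 : (1 : ℝ) < b := by exact_mod_cast (by omega : 1 < b)
  have hpos : ∀ n : ℕ, (0 : ℝ) < (b : ℝ) ^ n := fun n => by positivity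
  have hG : LocallyIntegrable ((cube (Fin s)).indicator g) volume :=
    ((integrable_indicator_iff measurableSet_Icc).2 hg).locallyIntegrable
  have hL := IsUnifLocDoublingMeasure.ae_tendsto_average (volume : Measure (Fin s → ℝ)) hG 1
  filter_upwards [ae_restrict_of_ae hL, ae_cube_mem_Ico, ae_restrict_mem measurableSet_Icc]
    with x hxL hx hxc
  have hlim : Tendsto (fun n : ℕ => 1 / 2 / (b : ℝ) ^ n) atTop (𝓝[>] 0) := by
    refine tendsto_nhdsWithin_iff.2 ⟨?_, Eventually.of_forall fun n => ?_⟩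
    · exact Tendsto.div_atTop tendsto_const_nhds (tendsto_pow_atTop_atTop_of_one_lt hb1)
    · exact div_pos (by norm_num) (hpos n)
  -- The centres move with `n`; it suffices that `x` stays within one radius of them.
  have := hxL (fun n i => (⌊x i * (b : ℝ) ^ n⌋₊ + 1 / 2) / (b : ℝ) ^ n) _ hlim
    (Eventually.of_forall fun n => by
      rw [one_mul, Metric.mem_closedBall, dist_pi_le_iff (by positivity)]
      intro i
      have h1 := Nat.floor_le (mul_nonneg (hx i).1 (hpos n).le)
      have h2 := Nat.lt_floor_add_one (x i * (b : ℝ) ^ n)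
      rw [Real.dist_eq, le_div_iff₀ (hpos n), ← abs_of_pos (hpos n), ← abs_mul, abs_of_pos (hpos n),
        sub_mul, div_mul_cancel₀ _ (hpos n).ne', abs_le]
      constructor <;> linarith)
  rw [Set.indicator_of_mem hxc] at this
  exact this.congr fun n => (tensorInt_cellKernel hb g n hx).symm

/-! ### The truncation error -/

open Filter Topology in
/-- The pointwise bound of the truncation error. -/
theorem ae_norm_sub_walshPartial_le (hs : 1 ≤ s) {b α : ℕ} (hb : 2 ≤ b) (hα : 2 ≤ α) {p : ℝ≥0∞}
    (hp : 1 ≤ p) {g : (Fin s → ℝ) → ℝ} {D : (Fin s → ℕ) → (Fin s → ℝ) → ℝ}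
    (hD : IsWeakMixedDerivFamily α g D) (hfin : familyNorm p α D < ∞) {ν : ℕ} (hν : 1 ≤ ν) :
    ∀ᵐ x ∂volume.restrict (cube (Fin s)),
      ‖(g x : ℂ) - walshPartial b (crossIndex s b ν) g x‖ ≤
        (α * (2 ^ α * b)) ^ s * tailConst s b * (ν : ℝ) ^ s * ((b : ℝ) ^ ν)⁻¹ *
          (familyNorm p α D).toReal := by
  have hD0 := hD 0 fun _ => Nat.zero_le _
  filter_upwards [ae_tendsto_tensorInt_cellKernel hb hD0.integrableOn, ae_cube_mem_Ico]
    with x hlim hx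
  have hlim' : Tendsto (fun n => ‖((tensorInt g (fun i => cellKernel b n (x i)) : ℝ) : ℂ) -
      walshPartial b (crossIndex s b ν) g x‖) atTop
      (𝓝 ‖(g x : ℂ) - walshPartial b (crossIndex s b ν) g x‖) :=
    (((Complex.continuous_ofReal.tendsto _).comp hlim).sub_const _).norm
  -- The bound for the box partial sums does not depend on `n`, so it passes to the limit.
  refine le_of_tendsto hlim' ?_
  filter_upwards [eventually_ge_atTop ν] with n hn
  have hbox : walshPartial b (boxIndex b fun _ => n) g x =
      (tensorInt g (fun i => cellKernel b n (x i)) : ℂ) :=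
    walshPartial_piFinset hD0.integrableOn b _ x fun i z hz => sum_range_walsh₁ hb n (hx i) hz
  rw [← hbox, walshPartial_box_sub_cross hs hb hn]
  refine (norm_sum_le _ _).trans ?_
  have hterm : ∀ a ∈ (Fintype.piFinset fun _ : Fin s => Finset.range (n + 1)).filter
      (ν < ∑ j, · j), ‖walshPartial b (Fintype.piFinset fun j => level b (a j)) g x‖ ≤
        (α * (2 ^ α * b)) ^ s * (familyNorm p α D).toReal * ((b : ℝ) ^ ∑ j, a j)⁻¹ := by
    intro a _
    rw [walshPartial_piFinset hD0.integrableOn b _ x fun i z hz => sum_level_walsh₁ hb _ (hx i) hz,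
      Complex.norm_real, Real.norm_eq_abs]
    obtain ⟨K, hK⟩ := exists_uniform_bddMeas fun i => bddMeas_levelKernel b (a i) (x i)
    rw [tensorInt_eq_of_weak_zero hD0 hK]
    exact (abs_tensorInt_levelKernels_le hp hα hD hfin hb a hx).trans (le_of_eq (by ring))
  refine (Finset.sum_le_sum hterm).trans ?_
  rw [← Finset.mul_sum]
  refine (mul_le_mul_of_nonneg_left (sum_level_tail_le hb hν n) (by positivity)).trans
    (le_of_eq (by ring))

end WalshTrunc

end

theorem mainTheorem5 (s b α : ℕ) (p : ℝ≥0∞) (hs : 1 ≤ s) (hb : 2 ≤ b) (hα : 2 ≤ α)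
    (hp : 1 ≤ p) :
    ∃ C : ℝ, 0 < C ∧ ∀ g : (Fin s → ℝ) → ℝ, WalshTrunc.mixedNorm p α g < ∞ →
      ∀ ν : ℕ, 1 ≤ ν →
        eLpNorm
            (fun x => (g x : ℂ) -
              WalshTrunc.walshPartial b (WalshTrunc.crossIndex s b ν) g x)
            ∞ (volume.restrict (WalshTrunc.cube (Fin s))) ≤
          ENNReal.ofReal (C * (ν : ℝ) ^ (2 * s - 1) * ((b : ℝ) ^ ν)⁻¹) *
            WalshTrunc.mixedNorm p α g := by
  set C₀ : ℝ := (α * (2 ^ α * b)) ^ s * WalshTrunc.tailConst s b with hC₀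
  have hC₀nn : 0 ≤ C₀ := mul_nonneg (by positivity) (WalshTrunc.tailConst_nonneg s b)
  -- Adding `1` serves only to make the constant positive.
  refine ⟨C₀ + 1, by positivity, fun g hg ν hν => ?_⟩
  by_cases hex : ∃ D, WalshTrunc.IsWeakMixedDerivFamily α g D
  swap
  · rw [WalshTrunc.mixedNorm, dif_neg hex] at hg
    exact absurd hg (lt_irrefl _)
  rw [WalshTrunc.mixedNorm, dif_pos hex] at hg ⊢
  rw [eLpNorm_exponent_top, ← ENNReal.ofReal_toReal hg.ne,
    ← ENNReal.ofReal_mul (by positivity)]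
  refine eLpNormEssSup_le_of_ae_bound ?_
  -- The bound holds for every family of weak derivatives, hence for the chosen one; uniqueness of
  -- weak derivatives plays no role.
  filter_upwards [WalshTrunc.ae_norm_sub_walshPartial_le hs hb hα hp hex.choose_spec hg hν]
    with x hx
  refine hx.trans ?_
  have hν1 : (1 : ℝ) ≤ ν := by exact_mod_cast hν
  gcongr
  · linarith
  -- This is `s ≤ 2s - 1`, from `s ≥ 1`.
  · omega
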